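/- Let $X$ be a scheme, let $K$ be a complex of $\mathcal{O}_X$-modules (unbounded in both directions), and let $\varepsilon: K\to I$ be a Cartan–Eilenberg resolution of $K$. That is, $I=(I^{pq})_{p,q\in\mathbf{Z}}$ is a bigraded $\mathcal{O}_X$-module with differentials $d_I$ of bidegree $(1,0)$ and $d_{II}$ of bidegree $(0,1)$ such that $(d_I+d_{II})^2=0$, with $I^{pq}=0$ for $q<0$, and $\varepsilon$ is a morphism of bigraded differential modules, where $K$ is placed in the row $q=0$, such that for each $p$ the induced morphisms $$K^p\to I^{p,\bullet},\quad Z^pK\to Z^p_I I,\quad B^pK\to B^p_I I,\quad H^pK\to H^p_I I$$ (objects, cocycles, coboundaries and cohomology with respect to $d_I$) are injective resolutions in the category of $\mathcal{O}_X$-modules. Let $J=\widehat{\mathrm{Tot}}\,I$ be the product total complex, $J^n=\prod_{p+q=n}I^{pq}$, with differential $d_I+d_{II}$, and let $\eta:K\to J$ be the morphism of complexes induced by $\varepsilon$. The Cartan–Eilenberg hypercohomology of $K$ is the cohomology of the complex of abelian groups $\mathbf{R}\Gamma_{ce}(X,K)=\Gamma(X,J)$. Then: a) The complex $J$ is $K$-injective,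 i.e. every morphism of complexes from an acyclic complex of $\mathcal{O}_X$-modules to $J$ is homotopic to zero. b) If all homology sheaves $H^nK$, $n\in\mathbf{Z}$, are quasi-coherent, then $\eta:K\to J$ is a quasi-isomorphism. Hence the Cartan–Eilenberg hypercohomology of $K$ coincides with its derived functor hypercohomology in the sense of Spaltenstein: the right derived functor $\mathbf{R}\Gamma(X,-)$ of $\Gamma(X,-)$ is defined at $K$, and the canonical morphism $\mathbf{R}\Gamma_{ce}(X,K)=\Gamma(X,J)\to\mathbf{R}\Gamma(X,K)$ in the derived category of abelian groups is an isomorphism; moreover, for every quasi-isomorphism $s:K\to L$ with $L$ a $K$-injective complex, there is a morphism of complexes $\varphi:J\to L$, unique up to homotopy, such that $\varphi\eta$ is homotopic to $s$, and it induces isomorphisms $H^n\Gamma(X,J)\to H^n\Gamma(X,L)$ for all $n\in\mathbf{Z}$. -/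

import Mathlib

open CategoryTheory CategoryTheory.Limits AlgebraicGeometry

noncomputable section

namespace CartanEilenberg

section Bicomplex

universe v u

variable {C : Type u} [Category.{v} C] [Abelian C]

/-! A bicomplex `I` is given by its rows: `I.X q` is the row of index `q`,
`(I.X q).X p` is the object `I^{p,q}`, `d_I` is the differential `(I.X q).d p (p + 1)` of the rows
and `(I.d q (q + 1)).f p` is the vertical differential.  As usual in Mathlib, the two differentials
commute; the anticommuting second differential is `d_II = (-1)^p (I.d q (q + 1)).f p`, which is the
sign that enters into the total complex below. -/

/-- The functor which sends a complex `K` to its differential `K^{p-1} ⟶ K^p`. -/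
def differentialFunctor (C : Type u) [Category.{v} C] [Abelian C] (p : ℤ) :
    CochainComplex C ℤ ⥤ Arrow C where
  obj K := Arrow.mk (K.d (p - 1) p)
  map f := Arrow.homMk (f.f (p - 1)) (f.f p) (f.comm (p - 1) p)

/-- The functor which sends a complex `K` to its object `B^p K` of coboundaries, that is, to the
image of `K^{p-1} ⟶ K^p`. -/
def boundariesFunctor (C : Type u) [Category.{v} C] [Abelian C] (p : ℤ) :
    CochainComplex C ℤ ⥤ C :=
  differentialFunctor C p ⋙ im

instance (p : ℤ) : (boundariesFunctor C p).PreservesZeroMorphisms where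
  map_zero K L := by
    apply (cancel_mono (image.ι (L.d (p - 1) p))).1
    exact (image.map_ι _).trans (comp_zero.trans zero_comp.symm)

/-- A morphism from an object `M`, placed in degree `0`, to a complex `L` is an injective
resolution of `M`: the components of `L` are injective and vanish in negative degrees, and the
morphism is a quasi-isomorphism. -/
structure IsInjectiveResolution {M : C} {L : CochainComplex C ℤ}
    (a : (HomologicalComplex.single C (ComplexShape.up ℤ) 0).obj M ⟶ L) : Prop where
  injective : ∀ q : ℤ, Injective (L.X q)
  isZero : ∀ q : ℤ, q < 0 → IsZero (L.X q)
  quasiIso : QuasiIso a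

/-- Let `Φ` be one of the functors `K ↦ K^p`, `Z^p K`, `B^p K`, `H^p K`.  If `I` is a bicomplex
with an augmentation `ε` from `K` (placed in the row of index `0`), then `Φ` applied to all rows
of `I` is a complex, and this is the augmentation `Φ K ⟶ Φ I` induced by `ε`. -/
def inducedAugmentation (Φ : CochainComplex C ℤ ⥤ C) [Φ.PreservesZeroMorphisms]
    {K : CochainComplex C ℤ} {I : CochainComplex (CochainComplex C ℤ) ℤ}
    (ε : (HomologicalComplex.single (CochainComplex C ℤ) (ComplexShape.up ℤ) 0).obj K ⟶ I) :
    (HomologicalComplex.single C (ComplexShape.up ℤ) 0).obj (Φ.obj K) ⟶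
      (Φ.mapHomologicalComplex (ComplexShape.up ℤ)).obj I :=
  (HomologicalComplex.singleMapHomologicalComplex Φ (ComplexShape.up ℤ) 0).inv.app K ≫
    (Φ.mapHomologicalComplex (ComplexShape.up ℤ)).map ε

/-- `ε : K ⟶ I` is a Cartan–Eilenberg resolution of the (unbounded) complex `K`: for each `p`,
the induced morphisms from `K^p`, `Z^p K`, `B^p K` and `H^p K` to the complexes `I^{p,•}`,
`Z^p_I I`, `B^p_I I` and `H^p_I I` are injective resolutions.  (In particular `I^{p,q}` vanishes
for `q < 0`.) -/
structure IsCartanEilenbergResolution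
    {K : CochainComplex C ℤ} {I : CochainComplex (CochainComplex C ℤ) ℤ}
    (ε : (HomologicalComplex.single (CochainComplex C ℤ) (ComplexShape.up ℤ) 0).obj K ⟶ I) :
    Prop where
  column : ∀ p : ℤ, IsInjectiveResolution
    (inducedAugmentation (HomologicalComplex.eval C (ComplexShape.up ℤ) p) ε)
  cycles : ∀ p : ℤ, IsInjectiveResolution
    (inducedAugmentation (HomologicalComplex.cyclesFunctor C (ComplexShape.up ℤ) p) ε)
  boundaries : ∀ p : ℤ, IsInjectiveResolution
    (inducedAugmentation (boundariesFunctor C p) ε)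
  homology : ∀ p : ℤ, IsInjectiveResolution
    (inducedAugmentation (HomologicalComplex.homologyFunctor C (ComplexShape.up ℤ) p) ε)

variable [HasCountableProducts C]

/-- The degree `n` component of the product total complex: the product of the `I^{p,q}` for
`p + q = n`. -/
def prodTotalX (I : CochainComplex (CochainComplex C ℤ) ℤ) (n : ℤ) : C :=
  ∏ᶜ fun x : {x : ℤ × ℤ // x.1 + x.2 = n} => (I.X x.1.2).X x.1.1

/-- The projection of the product total complex to `I^{p,q}`. -/
def prodTotalπ (I : CochainComplex (CochainComplex C ℤ) ℤ) (n p q : ℤ) (h : p + q = n) :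
    prodTotalX I n ⟶ (I.X q).X p :=
  Pi.π (fun x : {x : ℤ × ℤ // x.1 + x.2 = n} => (I.X x.1.2).X x.1.1) ⟨(p, q), h⟩

/-- A morphism to the product total complex is given by its components. -/
def prodTotalLift (I : CochainComplex (CochainComplex C ℤ) ℤ) (n : ℤ) {A : C}
    (f : ∀ p q : ℤ, p + q = n → (A ⟶ (I.X q).X p)) : A ⟶ prodTotalX I n :=
  Pi.lift fun x => f x.1.1 x.1.2 x.2

@[simp]
lemma prodTotalLift_π (I : CochainComplex (CochainComplex C ℤ) ℤ) (n : ℤ) {A : C}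
    (f : ∀ p q : ℤ, p + q = n → (A ⟶ (I.X q).X p)) (p q : ℤ) (h : p + q = n) :
    prodTotalLift I n f ≫ prodTotalπ I n p q h = f p q h := by
  exact Pi.lift_π _ _

@[simp]
lemma prodTotalLift_π_assoc (I : CochainComplex (CochainComplex C ℤ) ℤ) (n : ℤ) {A B : C}
    (f : ∀ p q : ℤ, p + q = n → (A ⟶ (I.X q).X p)) (p q : ℤ) (h : p + q = n)
    (g : (I.X q).X p ⟶ B) :
    prodTotalLift I n f ≫ prodTotalπ I n p q h ≫ g = f p q h ≫ g := by
  rw [← Category.assoc, prodTotalLift_π]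

lemma prodTotal_hom_ext (I : CochainComplex (CochainComplex C ℤ) ℤ) (n : ℤ) {A : C}
    {f g : A ⟶ prodTotalX I n}
    (h : ∀ (p q : ℤ) (hpq : p + q = n), f ≫ prodTotalπ I n p q hpq = g ≫ prodTotalπ I n p q hpq) :
    f = g :=
  Pi.hom_ext _ _ fun x => h x.1.1 x.1.2 x.2

/-- The differential `d_I + d_II` of the product total complex. -/
def prodTotalD (I : CochainComplex (CochainComplex C ℤ) ℤ) (n m : ℤ) (h : n + 1 = m) :
    prodTotalX I n ⟶ prodTotalX I m :=
  prodTotalLift I m fun p q hpq =>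
    prodTotalπ I n (p - 1) q (by lia) ≫ (I.X q).d (p - 1) p +
      p.negOnePow • (prodTotalπ I n p (q - 1) (by lia) ≫ (I.d (q - 1) q).f p)

/-- The product total complex of a bicomplex. -/
def prodTotal (I : CochainComplex (CochainComplex C ℤ) ℤ) : CochainComplex C ℤ where
  X n := prodTotalX I n
  d n m := if h : n + 1 = m then prodTotalD I n m h else 0
  shape n m h := dif_neg h
  d_comp_d' n m k h h' := by
    obtain rfl : n + 1 = m := h
    obtain rfl : n + 1 + 1 = k := h'
    rw [dif_pos rfl, dif_pos rfl]
    apply prodTotal_hom_ext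
    intro p q hpq
    have h₁ : (I.d (q - 1) q).f (p - 1) ≫ (I.X q).d (p - 1) p =
      (I.X (q - 1)).d (p - 1) p ≫ (I.d (q - 1) q).f p := (I.d (q - 1) q).comm _ _
    have h₂ : (I.d (q - 1 - 1) (q - 1)).f p ≫ (I.d (q - 1) q).f p = 0 := by
      rw [← HomologicalComplex.comp_f, I.d_comp_d, HomologicalComplex.zero_f]
    simp [prodTotalD, h₁, h₂, Int.negOnePow_sub, Linear.units_smul_comp]

/-- The morphism `η : K ⟶ J` from `K` to the product total complex `J` of `I` induced by an
augmentation `ε : K ⟶ I`: its component in `I^{p,q}` is `ε` if `q = 0` and zero otherwise. -/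
def totalAugmentation {K : CochainComplex C ℤ} {I : CochainComplex (CochainComplex C ℤ) ℤ}
    (ε : (HomologicalComplex.single (CochainComplex C ℤ) (ComplexShape.up ℤ) 0).obj K ⟶ I) :
    K ⟶ prodTotal I where
  f n := prodTotalLift I n fun p q hpq =>
    if hq : q = 0 then
      (K.XIsoOfEq (by lia : n = p)).hom ≫
        ((HomologicalComplex.singleObjXIsoOfEq (ComplexShape.up ℤ) 0 K q hq).inv ≫ ε.f q).f p
    else 0
  comm' n m hnm := by
    obtain rfl : n + 1 = m := hnm
    apply prodTotal_hom_ext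
    intro p q hpq
    simp only [prodTotal, prodTotalD, Category.assoc, prodTotalLift_π, dite_true,
      Preadditive.comp_add, Linear.comp_units_smul, prodTotalLift_π_assoc]
    by_cases hq : q = 0
    · subst hq
      obtain rfl : n = p - 1 := by lia
      have h := (((HomologicalComplex.singleObjXIsoOfEq (ComplexShape.up ℤ) 0 K 0 rfl).inv ≫
        ε.f 0)).comm (p - 1) p
      simp only [dite_true, Category.assoc, h, HomologicalComplex.XIsoOfEq_rfl]
      rw [dif_neg (by lia)]
      simp
    · rw [dif_neg hq, dif_neg hq]
      by_cases hq' : q - 1 = 0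
      · obtain rfl : q = 1 := by lia
        simp
      · rw [dif_neg hq']
        simp

end Bicomplex

section DerivedFunctor

universe w₁ w₂ v₁ v₂ u₁ u₂

variable {C : Type u₁} [Category.{v₁} C] [Abelian C] [HasDerivedCategory.{w₁} C]
  {D : Type u₂} [Category.{v₂} D] [Abelian D] [HasDerivedCategory.{w₂} D]

/-- The functor from the homotopy category of `C` to the derived category of `D` induced by an
additive functor `F`. -/
abbrev homotopyToDerived (F : C ⥤ D) [F.Additive] :
    HomotopyCategory C (ComplexShape.up ℤ) ⥤ DerivedCategory D :=
  F.mapHomotopyCategory (ComplexShape.up ℤ) ⋙ DerivedCategory.Qh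

/-- The right derived functor of `F` with respect to quasi-isomorphisms is (pointwise) defined at
the complex `K`. -/
abbrev HasRightDerivedAt (F : C ⥤ D) [F.Additive] (K : CochainComplex C ℤ) : Prop :=
  (homotopyToDerived F).HasPointwiseRightDerivedFunctorAt
    (HomotopyCategory.quasiIso C (ComplexShape.up ℤ)) ((HomotopyCategory.quotient _ _).obj K)

/-- The value `RF K` of the right derived functor of `F` at `K`, if it is defined there: the colimit
of the `F K'` over all complexes `K'` up to homotopy, equipped with a morphism `K' ⟶ K` in the
derived category. -/
def rightDerivedAt (F : C ⥤ D) [F.Additive] (K : CochainComplex C ℤ) [HasRightDerivedAt F K] :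
    DerivedCategory D :=
  have := Functor.HasPointwiseRightDerivedFunctorAt.hasColimit (homotopyToDerived F)
    DerivedCategory.Qh (HomotopyCategory.quasiIso C (ComplexShape.up ℤ))
    ((HomotopyCategory.quotient _ _).obj K)
  colimit (CostructuredArrow.proj DerivedCategory.Qh
    (DerivedCategory.Qh.obj ((HomotopyCategory.quotient _ _).obj K)) ⋙ homotopyToDerived F)

/-- For a quasi-isomorphism `η : K ⟶ J`, the canonical morphism `F J ⟶ RF J ≅ RF K` in the derived
category, that is, the structural morphism of the colimit `RF K` which corresponds to `J` and
to the inverse of `η` in the derived category. -/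
def toRightDerivedAt (F : C ⥤ D) [F.Additive] {K J : CochainComplex C ℤ} (η : K ⟶ J) [QuasiIso η]
    [HasRightDerivedAt F K] :
    DerivedCategory.Q.obj ((F.mapHomologicalComplex (ComplexShape.up ℤ)).obj J) ⟶
      rightDerivedAt F K :=
  have := Functor.HasPointwiseRightDerivedFunctorAt.hasColimit (homotopyToDerived F)
    DerivedCategory.Qh (HomotopyCategory.quasiIso C (ComplexShape.up ℤ))
    ((HomotopyCategory.quotient _ _).obj K)
  let i : DerivedCategory.Qh.obj ((HomotopyCategory.quotient _ _).obj J) ⟶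
      DerivedCategory.Qh.obj ((HomotopyCategory.quotient _ _).obj K) :=
    (DerivedCategory.quotientCompQhIso C).hom.app J ≫ inv (DerivedCategory.Q.map η) ≫
      (DerivedCategory.quotientCompQhIso C).inv.app K
  colimit.ι (CostructuredArrow.proj DerivedCategory.Qh
    (DerivedCategory.Qh.obj ((HomotopyCategory.quotient _ _).obj K)) ⋙ homotopyToDerived F)
    (CostructuredArrow.mk (Y := (HomotopyCategory.quotient _ _).obj J) i)

end DerivedFunctor

section Scheme

universe w₁ w₂ u

/-- The functor `Γ(X, -)` of global sections on the category of `𝒪_X`-modules. -/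
def globalSections (X : Scheme.{u}) : X.Modules ⥤ Ab.{u} :=
  Scheme.Modules.toPresheaf X ⋙ (evaluation _ _).obj (.op ⊤)

instance (X : Scheme.{u}) : (globalSections X).Additive where
  map_add := rfl

/-- The complex `Γ(X, J)`, where `J` is the product total complex of `I`.  If `I` is a
Cartan–Eilenberg resolution of `K`, this is the complex `RΓ_ce(X, K)`, whose cohomology is the
Cartan–Eilenberg hypercohomology of `K`. -/
def ceSections {X : Scheme.{u}} (I : CochainComplex (CochainComplex X.Modules ℤ) ℤ) :
    CochainComplex Ab.{u} ℤ :=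
  ((globalSections X).mapHomologicalComplex (ComplexShape.up ℤ)).obj (prodTotal I)

/-- The morphism `RΓ_ce(X, K) = Γ(X, J) ⟶ Γ(X, L)` induced by a morphism `φ : J ⟶ L`. -/
def ceSectionsMap {X : Scheme.{u}} {I : CochainComplex (CochainComplex X.Modules ℤ) ℤ}
    {L : CochainComplex X.Modules ℤ} (φ : prodTotal I ⟶ L) :
    ceSections I ⟶ ((globalSections X).mapHomologicalComplex (ComplexShape.up ℤ)).obj L :=
  ((globalSections X).mapHomologicalComplex (ComplexShape.up ℤ)).map φ

/-- The canonical morphism `RΓ_ce(X, K) ⟶ RΓ(X, K)` in the derived category of abelian groups, if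
`η : K ⟶ J` is a quasi-isomorphism. -/
def ceToDerived {X : Scheme.{u}} [HasDerivedCategory.{w₁} X.Modules] [HasDerivedCategory.{w₂} Ab.{u}]
    {K : CochainComplex X.Modules ℤ} {I : CochainComplex (CochainComplex X.Modules ℤ) ℤ}
    (ε : (HomologicalComplex.single (CochainComplex X.Modules ℤ) (ComplexShape.up ℤ) 0).obj K ⟶ I)
    [QuasiIso (totalAugmentation ε)] [HasRightDerivedAt (globalSections X) K] :
    DerivedCategory.Q.obj (ceSections I) ⟶ rightDerivedAt (globalSections X) K :=
  toRightDerivedAt (globalSections X) (totalAugmentation ε)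

end Scheme

end CartanEilenberg

end

universe w₁ w₂ u

open CartanEilenberg

namespace CartanEilenberg

universe v

/-! K-injectivity. Since the cocycles and coboundaries of each row are injective, the horizontal
differential of each row splits (`exists_isDifferentialSplitting`). A morphism from a shifted
acyclic complex to such a row is therefore homotopic to zero. For a morphism to `J` one builds the
null-homotopy row by row: once it is known in row `q`, the component in row `q + 1`, corrected by
the vertical differential, is again a chain map. Rows of negative index vanish, so the recursion
starts, and a map to a product is any family of components, so it never has to stop
(`isKInjective_prodTotal`).

Quasi-isomorphism. Composed with the projection of `J` to the row `q = 0`, the augmentation is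
injective on homology, because `H^p K` embeds in its resolution `H^p_I I`. For surjectivity a
cocycle of `J` is modified by a cocycle of `K` until its row-zero component is a coboundary, and a
primitive is then built row by row. The obstruction in each row is a class in `H^p_I I`. It can be
removed if `Hom(G, -)` is exact on `H^p_I I` in positive degrees, `G` being the object on which the
cocycle is defined. Infinitely many steps allow no refinement of `G` on the way, so one needs enough
objects `G` that are good for all `p` at once (`IsCartanEilenbergResolution.quasiIso`).

For a scheme, sums of extensions by zero of `𝒪_U` with `U` affine serve as `G`: the exactness says
that the quasi-coherent `H^p K`, resolved by `H^p_I I`, has no higher cohomology on affine opens.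
This is proved directly by a Mayer–Vietoris induction (`exists_d_app_eq`).

Comparison. A K-injective `J` quasi-isomorphic to `K` is terminal in the category indexing the
colimit that defines the derived functor, and quasi-isomorphisms between K-injective complexes are
homotopy equivalences. -/

/-- Serves both row-by-row recursions. `R` is the equation linking neighbouring rows and `P` the
invariant that makes the next step possible; it is only tracked from `-1` on, the values below `0`
being prescribed. -/
lemma exists_int_indexed_seq (T : ℤ → Type*) (P : ∀ q, T q → Prop)
    (R : ∀ q, T q → T (q + 1) → Prop) (z : ∀ q, T q) (hzP : P (-1) (z (-1)))
    (hzR : ∀ q, q + 1 < 0 → R q (z q) (z (q + 1)))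
    (step : ∀ q, -1 ≤ q → ∀ t, P q t → ∃ t', P (q + 1) t' ∧ R q t t') :
    ∃ g : ∀ q, T q, (∀ q, q < 0 → g q = z q) ∧ ∀ q, R q (g q) (g (q + 1)) := by
  obtain ⟨t₀, ht₀, hR₀⟩ := step (-1) le_rfl _ hzP
  choose f hf hfR using fun (k : ℕ) (t : {t : T k // P k t}) => step k (by lia) t.1 t.2
  let w : ∀ k : ℕ, {t : T k // P k t} :=
    fun k => Nat.rec (motive := fun k : ℕ => {t : T k // P k t}) ⟨t₀, ht₀⟩
      (fun k t => ⟨f k t, hf k t⟩) k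
  let g : ∀ q, T q := fun q =>
    if h : 0 ≤ q then (Int.toNat_of_nonneg h) ▸ (w q.toNat).1 else z q
  have hg (k : ℕ) : g k = (w k).1 := by
    have aux : ∀ (m : ℕ) (e : (m : ℤ) = k), e ▸ (w m).1 = (w k).1 := by
      intro m e
      obtain rfl : m = k := by exact_mod_cast e
      rfl
    exact (dif_pos (Int.natCast_nonneg k)).trans (aux (k : ℤ).toNat (by simp))
  have hg' (q : ℤ) (hq : q < 0) : g q = z q := dif_neg (by lia)
  refine ⟨g, hg', fun q => ?_⟩
  by_cases hq : 0 ≤ q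
  · obtain ⟨k, rfl⟩ := Int.eq_ofNat_of_zero_le hq
    have h := hg (k + 1)
    rw [hg k]
    refine Eq.subst (motive := fun t => R (k : ℤ) (w k).1 t) h.symm (hfR k (w k))
  · by_cases hq' : q + 1 < 0
    · rw [hg' _ hq', hg' q (by lia)]
      exact hzR q hq'
    · obtain rfl : q = -1 := by lia
      rw [hg' _ (by lia)]
      exact Eq.subst (motive := fun t => R (-1) (z (-1)) t) (hg 0).symm hR₀

/-! ### Split differentials and K-injectivity of the product total complex. -/

variable {C : Type u} [Category.{v} C] [Abelian C]

/-- A family of morphisms `t` such that `d t d = d`, that is, a splitting of all the differentials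
of a complex. -/
def IsDifferentialSplitting (R : CochainComplex C ℤ) (t : ∀ p' p : ℤ, R.X p' ⟶ R.X p) : Prop :=
  ∀ p p' : ℤ, p + 1 = p' → R.d p p' ≫ t p' p ≫ R.d p p' = R.d p p'

/-- Injectivity of `B^{p'}` gives a retraction of `R^{p'}` onto it, and injectivity of the cocycles
splits `R^{p'-1} → B^{p'}`; `t` is the retraction followed by the section. -/
lemma exists_isDifferentialSplitting (R : CochainComplex C ℤ) (hZ : ∀ p, Injective (R.cycles p))
    (hB : ∀ p, Injective ((boundariesFunctor C p).obj R)) :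
    ∃ t, IsDifferentialSplitting R t := by
  have key : ∀ p' p : ℤ, ∃ t : R.X p' ⟶ R.X p,
      p + 1 = p' → R.d p p' ≫ t ≫ R.d p p' = R.d p p' := by
    intro p' p
    by_cases h : p + 1 = p'
    · obtain rfl : p = p' - 1 := by lia
      let f := R.d (p' - 1) p'
      have : Injective (image f) := hB p'
      have := hZ (p' - 1)
      obtain ⟨r, hr⟩ : ∃ r : R.X p' ⟶ image f, image.ι f ≫ r = 𝟙 _ :=
        ⟨Injective.factorThru (𝟙 _) _, Injective.comp_factorThru _ _⟩
      have hw : R.iCycles (p' - 1) ≫ factorThruImage f = 0 := by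
        rw [← cancel_mono (image.ι f)]
        simp [f]
      let S := ShortComplex.mk _ _ hw
      have hS : S.Exact := by
        refine S.exact_of_f_is_kernel (KernelFork.IsLimit.ofι _ _
          (fun {W} a ha => R.liftCycles a p' (by simp) ?_) ?_ ?_)
        · rw [← image.fac (R.d (p' - 1) p')]
          exact (reassoc_of% ha) (image.ι f) |>.trans zero_comp
        · intro W a ha
          exact R.liftCycles_i a _ _ _
        · intro W a ha b hb
          rw [← cancel_mono (R.iCycles _)]
          simpa using hb
      have hE : S.ShortExact :=
        { exact := hS
          mono_f := inferInstanceAs (Mono (R.iCycles _))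
          epi_g := inferInstanceAs (Epi (factorThruImage f)) }
      have : Injective S.X₁ := hZ (p' - 1)
      let σ := hE.splittingOfInjective
      have hσ : σ.s ≫ factorThruImage f = 𝟙 _ := σ.s_g
      refine ⟨r ≫ σ.s, fun _ => ?_⟩
      have hfac : R.d (p' - 1) p' = factorThruImage f ≫ image.ι f := (image.fac _).symm
      have hσ' := reassoc_of% hσ
      have hr' := reassoc_of% hr
      dsimp only [S] at hσ'
      rw [hfac]
      simp only [Category.assoc]
      rw [hr', hσ']
    · exact ⟨0, fun h' => (h h').elim⟩
  choose t ht using key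
  exact ⟨t, fun p p' h => ht p' p h⟩

/-- If `R` has split differentials and injective objects of cycles, morphisms from (a shift of)
an acyclic complex to `R` are homotopic to zero. -/
lemma exists_homotopy_of_isDifferentialSplitting {A R : CochainComplex C ℤ} (hA : A.Acyclic)
    (hZ : ∀ p, Injective (R.cycles p)) {t : ∀ p' p : ℤ, R.X p' ⟶ R.X p}
    (ht : IsDifferentialSplitting R t) (q : ℤ)
    (a : ∀ p n : ℤ, p + q = n → (A.X n ⟶ R.X p))
    (ha : ∀ (p p' n n' : ℤ) (h : p + q = n) (h' : p' + q = n'),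
      A.d n n' ≫ a p' n' h' = a p n h ≫ R.d p p') :
    ∃ s : ∀ p n : ℤ, p + q + 1 = n → (A.X n ⟶ R.X p),
      ∀ (p n : ℤ) (h : p + q = n), a p n h =
        A.d n (n + 1) ≫ s p (n + 1) (by lia) + s (p - 1) n (by lia) ≫ R.d (p - 1) p := by
  have key : ∀ p n : ℤ, ∃ b : A.X (n + 1) ⟶ R.X p, b ≫ R.d p (p + 1) = 0 ∧
      ∀ h : p + q = n, A.d n (n + 1) ≫ b = a p n h - a p n h ≫ R.d p (p + 1) ≫ t (p + 1) p -
        a p n h ≫ t p (p - 1) ≫ R.d (p - 1) p := by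
    intro p n
    by_cases h : p + q = n
    · have := hZ p
      -- Removing the part of `a` that `t` contracts leaves `w`, which lands in the cocycles of `R`
      -- and kills the boundaries of `A`. As `A` is acyclic and the cocycles are injective, `w`
      -- extends along `A.d n (n + 1)`.
      let w := a p n h - a p n h ≫ R.d p (p + 1) ≫ t (p + 1) p -
        a p n h ≫ t p (p - 1) ≫ R.d (p - 1) p
      have hw : w ≫ R.d p (p + 1) = 0 := by
        simp [w, ht p (p + 1) rfl]
      have hw' : A.d (n - 1) n ≫ w = 0 := by
        have e := ha (p - 1) p (n - 1) n (by lia) h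
        simp only [w, Preadditive.comp_sub, reassoc_of% e, e]
        simp [ht (p - 1) p (by lia)]
      have hex := hA n
      rw [A.exactAt_iff' (n - 1) n (n + 1) (by simp) (by simp)] at hex
      have hw'' : A.d (n - 1) n ≫ R.liftCycles w (p + 1) (by simp) hw = 0 := by
        rw [← cancel_mono (R.iCycles _)]
        simpa using hw'
      obtain ⟨β, hβ⟩ : ∃ β : A.X (n + 1) ⟶ R.cycles p,
          A.d n (n + 1) ≫ β = R.liftCycles w (p + 1) (by simp) hw :=
        ⟨hex.descToInjective _ hw'', hex.comp_descToInjective _ hw''⟩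
      refine ⟨β ≫ R.iCycles p, by simp, fun _ => ?_⟩
      rw [reassoc_of% hβ, R.liftCycles_i]
    · exact ⟨0, by simp, fun h' => (h h').elim⟩
  choose b hb hb' using key
  refine ⟨fun p n h => a (p + 1) n (by lia) ≫ t (p + 1) p +
    (A.XIsoOfEq (by lia : n = n - 1 + 1)).hom ≫ b p (n - 1), fun p n h => ?_⟩
  have e := ha p (p + 1) n (n + 1) h (by lia)
  have e₁ : (A.XIsoOfEq (by lia : n + 1 = n + 1 - 1 + 1)).hom ≫ b p (n + 1 - 1) = b p n := by
    have : ∀ (m : ℤ) (hm : n + 1 = m + 1), (A.XIsoOfEq hm).hom ≫ b p m = b p n := by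
      intro m hm
      obtain rfl : n = m := by lia
      simp
    exact this _ _
  have e₂ : b (p - 1) (n - 1) ≫ R.d (p - 1) p = 0 := by
    have := hb (p - 1) (n - 1)
    rwa [show p - 1 + 1 = p by lia] at this
  have e₃ : ∀ (p' : ℤ) (hp : p' = p), a p' n (by lia) ≫ t p' (p - 1) ≫ R.d (p - 1) p =
    a p n h ≫ t p (p - 1) ≫ R.d (p - 1) p := by
      rintro _ rfl; rfl
  simp only [Preadditive.comp_add, Preadditive.add_comp, Category.assoc, e₁, e₂, comp_zero,
    reassoc_of% e, hb' p n h]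
  rw [e₃ (p - 1 + 1) (by lia)]
  abel

section

variable [HasCountableProducts C]

/-- The projection of the product total complex to `I^{p,q}`. -/
noncomputable def totalπ (I : CochainComplex (CochainComplex C ℤ) ℤ) (n p q : ℤ) (h : p + q = n) :
    (prodTotal I).X n ⟶ (I.X q).X p :=
  prodTotalπ I n p q h

/-- A morphism to the product total complex is given by its components. -/
noncomputable def totalLift (I : CochainComplex (CochainComplex C ℤ) ℤ) (n : ℤ) {A : C}
    (f : ∀ p q : ℤ, p + q = n → (A ⟶ (I.X q).X p)) : A ⟶ (prodTotal I).X n :=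
  prodTotalLift I n f

@[simp]
lemma totalLift_π (I : CochainComplex (CochainComplex C ℤ) ℤ) (n : ℤ) {A : C}
    (f : ∀ p q : ℤ, p + q = n → (A ⟶ (I.X q).X p)) (p q : ℤ) (h : p + q = n) :
    totalLift I n f ≫ totalπ I n p q h = f p q h :=
  prodTotalLift_π I n f p q h

@[simp]
lemma totalLift_π_assoc (I : CochainComplex (CochainComplex C ℤ) ℤ) (n : ℤ) {A B : C}
    (f : ∀ p q : ℤ, p + q = n → (A ⟶ (I.X q).X p)) (p q : ℤ) (h : p + q = n)
    (g : (I.X q).X p ⟶ B) :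
    totalLift I n f ≫ totalπ I n p q h ≫ g = f p q h ≫ g :=
  prodTotalLift_π_assoc I n f p q h g

lemma total_hom_ext (I : CochainComplex (CochainComplex C ℤ) ℤ) {n : ℤ} {A : C}
    {f g : A ⟶ (prodTotal I).X n}
    (h : ∀ (p q : ℤ) (hpq : p + q = n), f ≫ totalπ I n p q hpq = g ≫ totalπ I n p q hpq) :
    f = g :=
  prodTotal_hom_ext I n h

lemma total_d_π (I : CochainComplex (CochainComplex C ℤ) ℤ) (n m p q : ℤ) (h : p + q = m)
    (hnm : n + 1 = m) :
    (prodTotal I).d n m ≫ totalπ I m p q h =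
      totalπ I n (p - 1) q (by lia) ≫ (I.X q).d (p - 1) p +
      p.negOnePow • (totalπ I n p (q - 1) (by lia) ≫ (I.d (q - 1) q).f p) := by
  simp only [prodTotal, dif_pos hnm, prodTotalD]
  exact prodTotalLift_π _ _ _ _ _ _

/-- The null-homotopy is found one row at a time, each row being handled by
`exists_homotopy_of_isDifferentialSplitting`. -/
lemma isKInjective_prodTotal (I : CochainComplex (CochainComplex C ℤ) ℤ)
    (hI : ∀ q < 0, ∀ p, IsZero ((I.X q).X p))
    (hZ : ∀ p q, Injective ((I.X q).cycles p))
    (hB : ∀ p q, Injective ((boundariesFunctor C p).obj (I.X q))) :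
    (prodTotal I).IsKInjective where
  nonempty_homotopy_zero {A} f hA := by
    choose t ht using fun q =>
      exists_isDifferentialSplitting (I.X q) (fun p => hZ p q) (fun p => hB p q)
    let F (p q n : ℤ) (h : p + q = n) : A.X n ⟶ (I.X q).X p := f.f n ≫ totalπ I n p q h
    have hF (p q n n' : ℤ) (h : p + q = n') (h' : n + 1 = n') : A.d n n' ≫ F p q n' h =
        F (p - 1) q n (by lia) ≫ (I.X q).d (p - 1) p +
        p.negOnePow • (F p (q - 1) n (by lia) ≫ (I.d (q - 1) q).f p) := by
      simp only [F]
      rw [← f.comm_assoc, total_d_π I n n' p q h h']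
      simp
    let T (q : ℤ) := ∀ p n : ℤ, p + q + 1 = n → (A.X n ⟶ (I.X q).X p)
    -- What the homotopy in row `q + 1` has to bound. The invariant of the recursion is that it
    -- commutes with the horizontal differentials.
    let a (q : ℤ) (s : T q) (p n : ℤ) (h : p + (q + 1) = n) : A.X n ⟶ (I.X (q + 1)).X p :=
      F p (q + 1) n h - p.negOnePow • (s p n (by lia) ≫ (I.d q (q + 1)).f p)
    obtain ⟨s, hs, hs'⟩ := exists_int_indexed_seq T
      (fun q s => ∀ (p p' n n' : ℤ) (h : p + (q + 1) = n) (h' : p' + (q + 1) = n'),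
        A.d n n' ≫ a q s p' n' h' = a q s p n h ≫ (I.X (q + 1)).d p p')
      (fun q s s' => ∀ (p n : ℤ) (h : p + (q + 1) = n), a q s p n h =
        A.d n (n + 1) ≫ s' p (n + 1) (by lia) +
          s' (p - 1) n (by lia) ≫ (I.X (q + 1)).d (p - 1) p)
      (fun _ _ _ _ => 0)
      (by
        intro p p' n n' h h'
        by_cases hp : p + 1 = p'
        · obtain rfl : p = p' - 1 := by lia
          have e := hF p' (-1 + 1) n n' h' (by lia)
          have e' : F p' (-1 + 1 - 1) n (by lia) = 0 := (hI _ (by lia) _).eq_of_tgt _ _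
          rw [e', zero_comp, smul_zero, add_zero] at e
          simp only [a, zero_comp, smul_zero, sub_zero]
          exact e
        · rw [A.shape n n' (fun e : n + 1 = n' => by lia), (I.X _).shape p p' hp, zero_comp,
            comp_zero])
      (fun q hq p n h => (hI _ hq _).eq_of_tgt _ _)
      (by
        intro q hq s hs
        obtain ⟨s', hs'⟩ := exists_homotopy_of_isDifferentialSplitting hA (fun p => hZ p (q + 1))
          (ht (q + 1)) (q + 1) (a q s) hs
        -- The invariant passes to the next row: substitute the homotopy equation of row `q + 1`
        -- into the chain map equation of `f`; the terms with two vertical differentials vanish.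
        refine ⟨fun p n h => s' p n (by lia), ?_, hs'⟩
        intro p p' n n' h h'
        by_cases hp : p + 1 = p'
        · obtain rfl : p = p' - 1 := by lia
          obtain rfl : n' = n + 1 := by lia
          have e₁ := hF p' (q + 1 + 1) n (n + 1) (by lia) rfl
          have e₂ : F p' (q + 1 + 1 - 1) n (by lia) ≫ (I.d (q + 1 + 1 - 1) (q + 1 + 1)).f p' =
              F p' (q + 1) n (by lia) ≫ (I.d (q + 1) (q + 1 + 1)).f p' := by
            rw! [show q + 1 + 1 - 1 = q + 1 by lia]
            rfl
          have e₃ := hs' p' n (by lia)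
          have e₄ : F p' (q + 1) n (by lia) = A.d n (n + 1) ≫ s' p' (n + 1) (by lia) +
              s' (p' - 1) n (by lia) ≫ (I.X (q + 1)).d (p' - 1) p' +
              p'.negOnePow • (s p' n (by lia) ≫ (I.d q (q + 1)).f p') := by
            rw [← e₃]; simp [a]
          have e₅ : (I.d q (q + 1)).f p' ≫ (I.d (q + 1) (q + 1 + 1)).f p' = 0 := by
            rw [← HomologicalComplex.comp_f, I.d_comp_d, HomologicalComplex.zero_f]
          rw [e₂, e₄] at e₁
          simp only [a, Preadditive.comp_sub, Preadditive.sub_comp, e₁]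
          simp [e₅, Int.negOnePow_sub, Linear.units_smul_comp, Linear.comp_units_smul]
          abel
        · rw [A.shape n n' (fun e : n + 1 = n' => by lia), (I.X _).shape p p' hp, zero_comp,
            comp_zero])
    refine ⟨{ hom := fun n m => if h : m + 1 = n then totalLift I m fun p q hpq =>
                s q p n (by lia) else 0
              zero := fun n m h => dif_neg h
              comm := fun n => ?_ }⟩
    apply total_hom_ext
    intro p q hpq
    rw [dNext_eq _ (show (ComplexShape.up ℤ).Rel n (n + 1) from rfl),
      prevD_eq _ (show (ComplexShape.up ℤ).Rel (n - 1) n by simp), dif_pos rfl,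
      dif_pos (by lia)]
    simp only [HomologicalComplex.zero_f, add_zero, Preadditive.add_comp, Category.assoc,
      totalLift_π, total_d_π I (n - 1) n p q hpq (by lia), Preadditive.comp_add, totalLift_π_assoc,
      Linear.comp_units_smul]
    have e := hs' (q - 1) p n (by lia)
    dsimp only [a] at e
    rw! [show q - 1 + 1 = q by lia] at e
    rw [sub_eq_iff_eq_add] at e
    rw [← add_assoc]
    exact e

end

end CartanEilenberg

namespace CartanEilenberg

universe v

variable {C : Type u} [Category.{v} C] [Abelian C]

/-! ### Homology of complexes with split differentials. -/

section Splitting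

variable {R : CochainComplex C ℤ} {t : ∀ p' p : ℤ, R.X p' ⟶ R.X p}

/-- The endomorphism on the right kills boundaries, so it descends to homology. With the two lemmas
below, this makes `Hom(G, -)` compute the homology of a row for every `G`, without refining `G`. -/
lemma IsDifferentialSplitting.exists_section (ht : IsDifferentialSplitting R t) (p : ℤ) :
    ∃ s : R.homology p ⟶ R.cycles p,
      R.homologyπ p ≫ s = 𝟙 _ - R.iCycles p ≫ t p (p - 1) ≫ R.toCycles (p - 1) p := by
  have h : R.toCycles (p - 1) p ≫
      (𝟙 _ - R.iCycles p ≫ t p (p - 1) ≫ R.toCycles (p - 1) p) = 0 := by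
    rw [← cancel_mono (R.iCycles p)]
    simp [ht (p - 1) p (by lia)]
  exact ⟨(R.homologyIsCokernel (p - 1) p (by simp)).desc (CokernelCofork.ofπ _ h),
    (R.homologyIsCokernel (p - 1) p (by simp)).fac (CokernelCofork.ofπ _ h) .one⟩

lemma IsDifferentialSplitting.exists_lift (ht : IsDifferentialSplitting R t) (p : ℤ) {G : C}
    (x : G ⟶ R.homology p) : ∃ z : G ⟶ R.cycles p, z ≫ R.homologyπ p = x := by
  obtain ⟨s, hs⟩ := ht.exists_section p
  have : s ≫ R.homologyπ p = 𝟙 _ := by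
    rw [← cancel_epi (R.homologyπ p), reassoc_of% hs]
    simp
  exact ⟨x ≫ s, by simp [this]⟩

lemma IsDifferentialSplitting.exists_comp_d_eq (ht : IsDifferentialSplitting R t) (p p' : ℤ)
    (hp : p' + 1 = p) {G : C} (z : G ⟶ R.cycles p) (hz : z ≫ R.homologyπ p = 0) :
    ∃ b : G ⟶ R.X p', b ≫ R.d p' p = z ≫ R.iCycles p := by
  obtain rfl : p' = p - 1 := by lia
  obtain ⟨s, hs⟩ := ht.exists_section p
  have e : z = (z ≫ R.iCycles p ≫ t p (p - 1)) ≫ R.toCycles (p - 1) p := by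
    have : z ≫ R.homologyπ p ≫ s = 0 := by rw [reassoc_of% hz, zero_comp]
    rw [hs] at this
    simpa [sub_eq_zero] using this
  refine ⟨z ≫ R.iCycles p ≫ t p (p - 1), ?_⟩
  conv_rhs => rw [e]
  simp

end Splitting

/-- The functor `Hom(G, -)` preserves the exactness of the complex `L` in positive degrees. -/
def IsHomExact (G : C) (L : CochainComplex C ℤ) : Prop :=
  ∀ i j k : ℤ, i + 1 = j → j + 1 = k → 1 ≤ j → ∀ x : G ⟶ L.X j, x ≫ L.d j k = 0 →
    ∃ y : G ⟶ L.X i, y ≫ L.d i j = x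

variable {K : CochainComplex C ℤ} {I : CochainComplex (CochainComplex C ℤ) ℤ}
    {ε : (HomologicalComplex.single (CochainComplex C ℤ) (ComplexShape.up ℤ) 0).obj K ⟶ I}

/-- The complex `H^p_I I`. -/
noncomputable abbrev rowHomology (I : CochainComplex (CochainComplex C ℤ) ℤ) (p : ℤ) :
    CochainComplex C ℤ :=
  ((HomologicalComplex.homologyFunctor C (ComplexShape.up ℤ) p).mapHomologicalComplex _).obj I

lemma IsHomExact.exists_homologyMap_eq {G : C} {p : ℤ} (hG : IsHomExact G (rowHomology I p))
    {i j k : ℤ} (hij : i + 1 = j) (hjk : j + 1 = k) (hj : 1 ≤ j) (x : G ⟶ (I.X j).homology p)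
    (hx : x ≫ HomologicalComplex.homologyMap (I.d j k) p = 0) :
    ∃ y : G ⟶ (I.X i).homology p, y ≫ HomologicalComplex.homologyMap (I.d i j) p = x :=
  hG i j k hij hjk hj x hx

namespace IsCartanEilenbergResolution

lemma isZero (hε : IsCartanEilenbergResolution ε) (q : ℤ) (hq : q < 0) (p : ℤ) :
    IsZero ((I.X q).X p) :=
  (hε.column p).isZero q hq

lemma injective_cycles (hε : IsCartanEilenbergResolution ε) (p q : ℤ) :
    Injective ((I.X q).cycles p) :=
  (hε.cycles p).injective q

lemma injective_boundaries (hε : IsCartanEilenbergResolution ε) (p q : ℤ) :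
    Injective ((boundariesFunctor C p).obj (I.X q)) :=
  (hε.boundaries p).injective q

lemma exists_isDifferentialSplitting (hε : IsCartanEilenbergResolution ε) (q : ℤ) :
    ∃ t, IsDifferentialSplitting (I.X q) t :=
  CartanEilenberg.exists_isDifferentialSplitting _ (fun p => hε.injective_cycles p q)
    (fun p => hε.injective_boundaries p q)

lemma isKInjective [HasCountableProducts C] (hε : IsCartanEilenbergResolution ε) :
    (prodTotal I).IsKInjective :=
  isKInjective_prodTotal I hε.isZero hε.injective_cycles hε.injective_boundaries

end IsCartanEilenbergResolution

/-! ### Primitives of cocycles of the product total complex. -/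

section Total

variable [HasCountableProducts C]

lemma total_d_π' (I : CochainComplex (CochainComplex C ℤ) ℤ) (n m p p' q q' : ℤ) (h : p' + q' = m)
    (hnm : n + 1 = m) (hp : p + 1 = p') (hq : q + 1 = q') :
    (prodTotal I).d n m ≫ totalπ I m p' q' h =
      totalπ I n p q' (by lia) ≫ (I.X q').d p p' +
      p'.negOnePow • (totalπ I n p' q (by lia) ≫ (I.d q q').f p') := by
  obtain rfl : p = p' - 1 := by lia
  obtain rfl : q = q' - 1 := by lia
  exact total_d_π I n m p' q' h hnm

lemma total_cocycle (I : CochainComplex (CochainComplex C ℤ) ℤ) {n n' p p' q q' : ℤ}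
    (h : p + q' = n) (hn : n + 1 = n') (hp : p + 1 = p') (hq : q + 1 = q')
    {G : C} {j : G ⟶ (prodTotal I).X n} (hj : j ≫ (prodTotal I).d n n' = 0) :
    (j ≫ totalπ I n p q' h) ≫ (I.X q').d p p' =
      - p'.negOnePow • (j ≫ totalπ I n p' q (by lia)) ≫ (I.d q q').f p' := by
  have e := hj =≫ totalπ I n' p' q' (by lia)
  rw [Category.assoc, total_d_π' I n n' p p' q q' (by lia) hn hp hq, zero_comp,
    Preadditive.comp_add, Linear.comp_units_smul] at e
  rw [Units.neg_smul, Category.assoc, Category.assoc]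
  exact eq_neg_of_add_eq_zero_left e

/-- The step in the construction of a primitive of a cocycle `j` of the product total complex. -/
lemma exists_primitive_step (I : CochainComplex (CochainComplex C ℤ) ℤ)
    {q q₁ q₂ p p₁ p₂ n n' : ℤ} (hq₁ : q + 1 = q₁) (hq₂ : q₁ + 1 = q₂) (hq : -1 ≤ q)
    (hp : p₁ + 1 = p) (hp₂ : p₂ + 1 = p₁) (h : p + q₁ = n) (h' : p₁ + q₂ = n) (hn : n + 1 = n')
    (ht : ∀ q, ∃ t, IsDifferentialSplitting (I.X q) t)
    {G : C} (hG : ∀ p, IsHomExact G (rowHomology I p))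
    (j : G ⟶ (prodTotal I).X n) (hj : j ≫ (prodTotal I).d n n' = 0)
    (b : G ⟶ (I.X q).X p) (c : G ⟶ (I.X q₁).X p₁)
    (hc : c ≫ (I.X q₁).d p₁ p = j ≫ totalπ I n p q₁ h - p.negOnePow • b ≫ (I.d q q₁).f p) :
    ∃ (b' : G ⟶ (I.X q₁).X p₁) (c' : G ⟶ (I.X q₂).X p₂),
      b' ≫ (I.X q₁).d p₁ p = j ≫ totalπ I n p q₁ h - p.negOnePow • b ≫ (I.d q q₁).f p ∧
      c' ≫ (I.X q₂).d p₂ p₁ =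
        j ≫ totalπ I n p₁ q₂ h' - p₁.negOnePow • b' ≫ (I.d q₁ q₂).f p₁ := by
  have hII : ∀ (i k l p : ℤ), (I.d i k).f p ≫ (I.d k l).f p = 0 := by
    intro i k l p
    rw [← HomologicalComplex.comp_f, I.d_comp_d, HomologicalComplex.zero_f]
  have sgn : p.negOnePow = - p₁.negOnePow := by rw [← hp, Int.negOnePow_succ]
  -- `v` should be a horizontal coboundary for the construction to continue. It is a horizontal
  -- cocycle, so the obstruction is its class in `H^{p₁}_I` of row `q₂`; this class is a vertical
  -- cocycle, because the vertical differential of `v` is a horizontal coboundary.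
  let v := j ≫ totalπ I n p₁ q₂ h' - p₁.negOnePow • c ≫ (I.d q₁ q₂).f p₁
  have hv : v ≫ (I.X q₂).d p₁ p = 0 := by
    have e := total_cocycle I h' hn hp hq₂ hj
    have e' := hc =≫ (I.d q₁ q₂).f p
    simp only [Category.assoc, Preadditive.sub_comp, Linear.units_smul_comp, hII, comp_zero,
      smul_zero, sub_zero] at e e'
    simp only [v, Preadditive.sub_comp, Category.assoc, e, Linear.units_smul_comp,
      HomologicalComplex.Hom.comm, e', sgn]
    simp
  have hv' : v ≫ (I.d q₂ (q₂ + 1)).f p₁ = -p₁.negOnePow •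
      ((j ≫ totalπ I n p₂ (q₂ + 1) (by lia)) ≫ (I.X (q₂ + 1)).d p₂ p₁) := by
    have e := total_cocycle I (show p₂ + (q₂ + 1) = n by lia) hn hp₂ rfl hj
    rw [e, smul_smul]
    simp [v, Preadditive.sub_comp, Linear.units_smul_comp, hII]
  let z := (I.X q₂).liftCycles v p (by simp; lia) hv
  have hz : (z ≫ (I.X q₂).homologyπ p₁) ≫
      HomologicalComplex.homologyMap (I.d q₂ (q₂ + 1)) p₁ = 0 := by
    rw [Category.assoc, HomologicalComplex.homologyπ_naturality,
      HomologicalComplex.liftCycles_comp_cyclesMap_assoc]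
    exact HomologicalComplex.liftCycles_homologyπ_eq_zero_of_boundary _ _ _ _
      (-p₁.negOnePow • (j ≫ totalπ I n p₂ (q₂ + 1) (by lia))) (by
        rw [hv', Linear.units_smul_comp])
  -- Exactness applies since `q ≥ -1` forces `q₂ ≥ 1`.
  obtain ⟨y, hy⟩ := (hG p₁).exists_homologyMap_eq hq₂ rfl (by lia) _ hz
  obtain ⟨t₁, ht₁⟩ := ht q₁
  obtain ⟨t₂, ht₂⟩ := ht q₂
  obtain ⟨w, rfl⟩ := ht₁.exists_lift p₁ y
  have hy' : (z - w ≫ HomologicalComplex.cyclesMap (I.d q₁ q₂) p₁) ≫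
      (I.X q₂).homologyπ p₁ = 0 := by
    rw [Category.assoc, HomologicalComplex.homologyπ_naturality] at hy
    rw [Preadditive.sub_comp, Category.assoc, hy, sub_self]
  obtain ⟨c', hc'⟩ := ht₂.exists_comp_d_eq p₁ p₂ hp₂ _ hy'
  -- Adding a horizontal cocycle to `c` leaves its equation intact and cancels the obstruction.
  refine ⟨c + p₁.negOnePow • w ≫ (I.X q₁).iCycles p₁, c', ?_, ?_⟩
  · rw [Preadditive.add_comp, hc, Linear.units_smul_comp]
    simp
  · rw [hc', Preadditive.sub_comp]
    simp only [z, HomologicalComplex.liftCycles_i, Category.assoc, HomologicalComplex.cyclesMap_i,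
      Preadditive.add_comp, Linear.units_smul_comp, smul_add, smul_smul, v]
    simp only [Int.units_mul_self, one_smul]
    abel

/-- The recursion looks one row ahead: its invariant is that the equation for the next component is
solvable. It starts with zero in row `-1`, where `c` solves the equation in row `0`; each step may
replace the solution at hand so that the following equation becomes solvable too. -/
lemma exists_primitive (I : CochainComplex (CochainComplex C ℤ) ℤ)
    (hI : ∀ q < 0, ∀ p, IsZero ((I.X q).X p))
    (ht : ∀ q, ∃ t, IsDifferentialSplitting (I.X q) t)
    {G : C} (hG : ∀ p, IsHomExact G (rowHomology I p)) {n m n' : ℤ} (hm : m + 1 = n)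
    (hn : n + 1 = n') (j : G ⟶ (prodTotal I).X n) (hj : j ≫ (prodTotal I).d n n' = 0)
    (c : G ⟶ (I.X 0).X m) (hc : c ≫ (I.X 0).d m n = j ≫ totalπ I n n 0 (by lia)) :
    ∃ b : G ⟶ (prodTotal I).X m, b ≫ (prodTotal I).d m n = j := by
  obtain ⟨s, hs, hs'⟩ := exists_int_indexed_seq (fun q => ∀ p, p + q = m → (G ⟶ (I.X q).X p))
    (fun q b => ∀ p (h : p + q = m), ∃ c : G ⟶ (I.X (q + 1)).X (p - 1),
      c ≫ (I.X (q + 1)).d (p - 1) p =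
        j ≫ totalπ I n p (q + 1) (by lia) - p.negOnePow • b p h ≫ (I.d q (q + 1)).f p)
    (fun q b b' => ∀ p (h : p + q = m), b' (p - 1) (by lia) ≫ (I.X (q + 1)).d (p - 1) p =
      j ≫ totalπ I n p (q + 1) (by lia) - p.negOnePow • b p h ≫ (I.d q (q + 1)).f p)
    (fun q p h => 0)
    (by
      intro p h
      obtain rfl : n = p := by lia
      obtain rfl : m = n - 1 := by lia
      exact ⟨c, by simpa using hc⟩)
    (fun q hq p h => (hI _ hq _).eq_of_tgt _ _)
    (by
      intro q hq b hb
      obtain ⟨c, hc⟩ := hb (m - q) (by lia)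
      obtain ⟨b', c', hb', hc'⟩ := exists_primitive_step I (p₂ := m - q - 1 - 1) rfl rfl hq (by lia)
        (by lia) _ (by lia) hn ht hG j hj _ c hc
      refine ⟨fun p h => b' ≫ ((I.X (q + 1)).XIsoOfEq (by lia)).hom, fun p h => ?_, fun p h => ?_⟩
      · obtain rfl : p = m - q - 1 := by lia
        exact ⟨c', by simpa using hc'⟩
      · obtain rfl : p = m - q := by lia
        simpa using hb')
  refine ⟨totalLift I m fun p q h => s q p h, ?_⟩
  apply total_hom_ext
  intro p q h
  rw [Category.assoc, total_d_π I m n p q h hm, Preadditive.comp_add, totalLift_π_assoc,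
    Linear.comp_units_smul, totalLift_π_assoc]
  have e := hs' (q - 1) p (by lia)
  rw! [show q - 1 + 1 = q by lia] at e
  rw [eq_sub_iff_add_eq] at e
  exact e

/-- The projection of the product total complex to the row of index `0`. -/
noncomputable def totalToRow (I : CochainComplex (CochainComplex C ℤ) ℤ)
    (hI : ∀ q < 0, ∀ p, IsZero ((I.X q).X p)) : prodTotal I ⟶ I.X 0 where
  f n := totalπ I n n 0 (by lia)
  comm' n m hnm := by
    -- Nothing enters row `0` vertically, which is why the projection is a chain map.
    have h : (I.d (0 - 1) 0).f m = 0 := (hI _ (by lia) _).eq_of_src _ _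
    obtain rfl : n = m - 1 := by simp at hnm; lia
    rw [total_d_π I (m - 1) m m 0 (by lia) (by lia), h]
    simp

/-- The augmentation as a morphism to the row of index `0`. -/
noncomputable def rowAugmentation
    (ε : (HomologicalComplex.single (CochainComplex C ℤ) (ComplexShape.up ℤ) 0).obj K ⟶ I) :
    K ⟶ I.X 0 :=
  (HomologicalComplex.singleObjXIsoOfEq (ComplexShape.up ℤ) 0 K 0 rfl).inv ≫ ε.f 0

lemma totalAugmentation_comp_totalToRow (hI : ∀ q < 0, ∀ p, IsZero ((I.X q).X p)) :
    totalAugmentation ε ≫ totalToRow I hI = rowAugmentation ε := by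
  ext n
  rw [HomologicalComplex.comp_f]
  dsimp only [totalAugmentation, totalToRow, totalπ, rowAugmentation]
  refine (prodTotalLift_π I n _ n 0 (add_zero n)).trans ?_
  simp

end Total

/-! ### Injective resolutions in low degrees. -/

section

variable {M : C} {L : CochainComplex C ℤ}
  {a : (HomologicalComplex.single C (ComplexShape.up ℤ) 0).obj M ⟶ L}

/-- Both complexes have zero differential into degree `0`, so cocycles there agree with homology. -/
lemma IsInjectiveResolution.isIso_cyclesMap (ha : IsInjectiveResolution a) :
    IsIso (HomologicalComplex.cyclesMap a 0) := by
  have := ha.quasiIso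
  have h : IsIso (HomologicalComplex.homologyMap a 0) := inferInstance
  have h₁ := HomologicalComplex.isIso_homologyπ
    ((HomologicalComplex.single C (ComplexShape.up ℤ) 0).obj M) (-1) 0 (by simp) (by simp)
  have h₂ := L.isIso_homologyπ (-1) 0 (by simp) ((ha.isZero _ (by lia)).eq_of_src _ _)
  have e := HomologicalComplex.homologyπ_naturality a 0
  rw [← IsIso.comp_inv_eq] at e
  rw [← e]
  infer_instance

/-- An injective resolution identifies `M` with the kernel of the first differential. -/
lemma IsInjectiveResolution.exists_lift (ha : IsInjectiveResolution a) {G : C} (x : G ⟶ L.X 0)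
    (hx : x ≫ L.d 0 1 = 0) : ∃ y : G ⟶ M,
      y ≫ (HomologicalComplex.singleObjXSelf (ComplexShape.up ℤ) 0 M).inv ≫ a.f 0 = x := by
  have := ha.isIso_cyclesMap
  refine ⟨L.liftCycles x 1 (by simp) hx ≫ inv (HomologicalComplex.cyclesMap a 0) ≫
    HomologicalComplex.iCycles _ 0 ≫
      (HomologicalComplex.singleObjXSelf (ComplexShape.up ℤ) 0 M).hom, ?_⟩
  simp [← HomologicalComplex.cyclesMap_i]

lemma IsInjectiveResolution.mono (ha : IsInjectiveResolution a) :
    Mono ((HomologicalComplex.singleObjXSelf (ComplexShape.up ℤ) 0 M).inv ≫ a.f 0) := by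
  have := ha.isIso_cyclesMap
  have h₁ := HomologicalComplex.isIso_iCycles
    ((HomologicalComplex.single C (ComplexShape.up ℤ) 0).obj M) 0 1 (by simp) (by simp)
  have e := HomologicalComplex.cyclesMap_i a 0
  have : Mono (a.f 0) := by
    rw [← IsIso.inv_comp_eq] at e
    rw [← e]
    infer_instance
  infer_instance

lemma IsInjectiveResolution.exactAt (ha : IsInjectiveResolution a) {q : ℤ} (hq : q ≠ 0) :
    L.ExactAt q := by
  have := ha.quasiIso
  rw [← quasiIsoAt_iff_exactAt a _ (HomologicalComplex.exactAt_single_obj _ _ _ _ hq)]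
  infer_instance

lemma IsInjectiveResolution.comp_d
    (a : (HomologicalComplex.single C (ComplexShape.up ℤ) 0).obj M ⟶ L) :
    ((HomologicalComplex.singleObjXSelf (ComplexShape.up ℤ) 0 M).inv ≫ a.f 0) ≫ L.d 0 1 = 0 := by
  simp

end

/-! ### The augmentation to the product total complex on homology. -/

namespace IsCartanEilenbergResolution

lemma inducedAugmentation_f_zero (p : ℤ) :
    (HomologicalComplex.singleObjXSelf (ComplexShape.up ℤ) 0 (K.homology p)).inv ≫
      (inducedAugmentation (HomologicalComplex.homologyFunctor C (ComplexShape.up ℤ) p) ε).f 0 =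
    HomologicalComplex.homologyMap (rowAugmentation ε) p := by
  have h : rowAugmentation ε =
    (HomologicalComplex.singleObjXSelf (ComplexShape.up ℤ) 0 K).inv ≫ ε.f 0 := rfl
  rw [h, HomologicalComplex.homologyMap_comp]
  dsimp only [inducedAugmentation]
  rw [HomologicalComplex.comp_f]
  have h₂ := HomologicalComplex.singleMapHomologicalComplex_inv_app_self
    (HomologicalComplex.homologyFunctor C (ComplexShape.up ℤ) p) (c := ComplexShape.up ℤ) 0 K
  exact (congr_arg (fun t => _ ≫ t ≫ _) h₂).trans (by
    erw [Category.assoc, Iso.inv_hom_id_assoc]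
    rfl)

lemma mono_homologyMap (hε : IsCartanEilenbergResolution ε) (p : ℤ) :
    Mono (HomologicalComplex.homologyMap (rowAugmentation ε) p) := by
  rw [← inducedAugmentation_f_zero]
  exact (hε.homology p).mono

lemma exists_homologyMap_eq (hε : IsCartanEilenbergResolution ε) (p : ℤ) {G : C}
    (x : G ⟶ (I.X 0).homology p) (hx : x ≫ HomologicalComplex.homologyMap (I.d 0 1) p = 0) :
    ∃ y : G ⟶ K.homology p, y ≫ HomologicalComplex.homologyMap (rowAugmentation ε) p = x := by
  rw [← inducedAugmentation_f_zero]
  exact (hε.homology p).exists_lift x hx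

variable [HasCountableProducts C]

/-- Injectivity on homology is visible in row `0`. For surjectivity, all refinements are made before
the infinite construction of `exists_primitive` starts, the last one to a `G` supplied by `h`. -/
lemma quasiIso (hε : IsCartanEilenbergResolution ε)
    (h : ∀ A : C, ∃ (G : C) (π : G ⟶ A), Epi π ∧ ∀ p, IsHomExact G (rowHomology I p)) :
    QuasiIso (totalAugmentation ε) := by
  rw [quasiIso_iff]
  intro n
  rw [quasiIsoAt_iff_isIso_homologyMap]
  have hI := hε.isZero
  have hη := totalAugmentation_comp_totalToRow (ε := ε) hI
  have : Mono (HomologicalComplex.homologyMap (totalAugmentation ε) n) := by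
    have := hε.mono_homologyMap n
    rw [← hη, HomologicalComplex.homologyMap_comp] at this
    exact mono_of_mono _ (HomologicalComplex.homologyMap (totalToRow I hI) n)
  have : Epi (HomologicalComplex.homologyMap (totalAugmentation ε) n) := by
    rw [epi_iff_surjective_up_to_refinements]
    intro A x
    obtain ⟨A₁, π₁, hπ₁, z, hz⟩ :=
      surjective_up_to_refinements_of_epi ((prodTotal I).homologyπ n) x
    have hz₁ : (z ≫ (prodTotal I).iCycles n) ≫ (prodTotal I).d n (n + 1) = 0 := by simp
    obtain ⟨w, hw⟩ := hε.exists_homologyMap_eq n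
      (z ≫ HomologicalComplex.cyclesMap (totalToRow I hI) n ≫ (I.X 0).homologyπ n) (by
        rw [Category.assoc, Category.assoc, HomologicalComplex.homologyπ_naturality,
          ← HomologicalComplex.cyclesMap_comp_assoc]
        -- The cocycle condition writes the vertical differential of the row-zero component as a
        -- horizontal coboundary, so its class comes from `H^n K`.
        have e := total_cocycle I (show n - 1 + 1 = n by lia) rfl (show n - 1 + 1 = n by lia)
          (zero_add 1) hz₁
        have e' : z ≫ HomologicalComplex.cyclesMap (totalToRow I hI ≫ I.d 0 1) n =
            ((-n.negOnePow • (z ≫ (prodTotal I).iCycles n) ≫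
              totalπ I n (n - 1) 1 (by lia)) ≫ (I.X 1).toCycles (n - 1) n) := by
          rw [← cancel_mono ((I.X 1).iCycles n)]
          simp only [Category.assoc, HomologicalComplex.cyclesMap_i, HomologicalComplex.toCycles_i,
            Linear.units_smul_comp] at e ⊢
          rw [e, smul_smul, Int.units_mul_self, one_smul]
          rfl
        rw [reassoc_of% e', HomologicalComplex.toCycles_comp_homologyπ, comp_zero])
    obtain ⟨A₂, π₂, hπ₂, w', hw'⟩ := surjective_up_to_refinements_of_epi (K.homologyπ n) w
    obtain ⟨G, π₃, hπ₃, hG⟩ := h A₂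
    -- After subtracting a cocycle of `K`, the row-zero component has zero class, and `y` is a
    -- coboundary in `J`.
    let y := π₃ ≫ π₂ ≫ z - π₃ ≫ w' ≫ HomologicalComplex.cyclesMap (totalAugmentation ε) n
    have hy : (y ≫ HomologicalComplex.cyclesMap (totalToRow I hI) n) ≫ (I.X 0).homologyπ n = 0 := by
      simp only [y, Preadditive.sub_comp, Category.assoc, ← hw, reassoc_of% hw',
        HomologicalComplex.homologyπ_naturality, ← HomologicalComplex.cyclesMap_comp_assoc, hη,
        sub_self]
    obtain ⟨t, ht⟩ := hε.exists_isDifferentialSplitting 0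
    obtain ⟨c, hc⟩ := ht.exists_comp_d_eq n (n - 1) (by lia) _ hy
    obtain ⟨b, hb⟩ := exists_primitive I hI hε.exists_isDifferentialSplitting hG
      (show n - 1 + 1 = n by lia) rfl (y ≫ (prodTotal I).iCycles n) (by simp) c (by
        rw [hc, Category.assoc, HomologicalComplex.cyclesMap_i, Category.assoc]
        rfl)
    have hb' : b ≫ (prodTotal I).toCycles (n - 1) n = y := by
      rw [← cancel_mono ((prodTotal I).iCycles n), Category.assoc, HomologicalComplex.toCycles_i,
        hb]
    have hyπ : y ≫ (prodTotal I).homologyπ n = 0 := by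
      rw [← hb', Category.assoc, HomologicalComplex.toCycles_comp_homologyπ, comp_zero]
    refine ⟨G, π₃ ≫ π₂ ≫ π₁, inferInstance, π₃ ≫ w' ≫ K.homologyπ n, ?_⟩
    simp only [y, Preadditive.sub_comp, Category.assoc, sub_eq_zero] at hyπ
    simpa only [Category.assoc, hz, HomologicalComplex.homologyπ_naturality] using hyπ
  exact isIso_of_mono_of_epi _

end IsCartanEilenbergResolution

end CartanEilenberg

namespace CartanEilenberg

noncomputable section

/-! ### Free sheaves of modules on representable presheaves. -/

section FreeYonedaSheaf

variable {C : Type u} [SmallCategory C] {J : GrothendieckTopology C} (R : Sheaf J RingCat.{u})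

/-- The functor which sends `U` to the free sheaf of modules on the presheaf represented
by `U`. -/
def freeYonedaSheaf : C ⥤ SheafOfModules.{u} R :=
  yoneda ⋙ PresheafOfModules.free R.obj ⋙ PresheafOfModules.sheafification (𝟙 R.obj)

variable {R}

/-- Morphisms from `freeYonedaSheaf U` to `F` are sections of `F` over `U`. -/
def freeYonedaSheafEquiv (U : C) (F : SheafOfModules.{u} R) :
    ((freeYonedaSheaf R).obj U ⟶ F) ≃ F.val.obj (.op U) :=
  ((PresheafOfModules.sheafificationAdjunction (𝟙 R.obj)).homEquiv _ _).trans
    (PresheafOfModules.freeYonedaEquiv (M := (F.val : PresheafOfModules R.obj)))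

lemma freeYonedaSheafEquiv_comp {U : C} {F F' : SheafOfModules.{u} R}
    (f : (freeYonedaSheaf R).obj U ⟶ F) (φ : F ⟶ F') :
    freeYonedaSheafEquiv U F' (f ≫ φ) = φ.val.app (.op U) (freeYonedaSheafEquiv U F f) := by
  have h := (PresheafOfModules.sheafificationAdjunction (𝟙 R.obj)).homEquiv_naturality_right
    (X := (PresheafOfModules.free R.obj).obj (yoneda.obj U)) f φ
  exact congr_arg (PresheafOfModules.freeYonedaEquiv (M := (F'.val : PresheafOfModules R.obj))) h

lemma freeYonedaEquiv_map_comp {R : Cᵒᵖ ⥤ RingCat.{u}} {M : PresheafOfModules.{u} R} {U V : C}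
    (i : V ⟶ U) (m : (PresheafOfModules.free R).obj (yoneda.obj U) ⟶ M) :
    PresheafOfModules.freeYonedaEquiv ((PresheafOfModules.free R).map (yoneda.map i) ≫ m) =
      M.map i.op (PresheafOfModules.freeYonedaEquiv m) := by
  have h := (PresheafOfModules.freeAdjunction R).homEquiv_naturality_left (yoneda.map i) m
  rw [PresheafOfModules.freeAdjunction_homEquiv, PresheafOfModules.freeAdjunction_homEquiv] at h
  refine (congr_arg yonedaEquiv h).trans ?_
  exact (yonedaEquiv_naturality _ _).symm

lemma freeYonedaSheafEquiv_map_comp {U V : C} (i : V ⟶ U) {F : SheafOfModules.{u} R}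
    (f : (freeYonedaSheaf R).obj U ⟶ F) :
    freeYonedaSheafEquiv V F ((freeYonedaSheaf R).map i ≫ f) =
      F.val.map i.op (freeYonedaSheafEquiv U F f) := by
  have h := (PresheafOfModules.sheafificationAdjunction (𝟙 R.obj)).homEquiv_naturality_left
    ((PresheafOfModules.free R.obj).map (yoneda.map i)) f
  refine (congr_arg (PresheafOfModules.freeYonedaEquiv
    (M := (F.val : PresheafOfModules R.obj))) h).trans ?_
  exact freeYonedaEquiv_map_comp (M := (F.val : PresheafOfModules R.obj)) i _

/-- The functor which forgets the module structure of sheaves of modules preserves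
epimorphisms. -/
lemma epi_toSheaf_map {M N : SheafOfModules.{u} R} (φ : M ⟶ N) [Epi φ] :
    Epi ((SheafOfModules.toSheaf R).map φ) := by
  let adj := PresheafOfModules.sheafificationAdjunction (𝟙 R.obj)
  let a := PresheafOfModules.sheafification (𝟙 R.obj)
  let G := SheafOfModules.forget R ⋙ PresheafOfModules.restrictScalars (𝟙 R.obj)
  let e := factorThruImage (G.map φ)
  let m := image.ι (G.map φ)
  -- Factor `φ` through its presheaf image and sheafify: the sheafified inclusion is mono and epi,
  -- hence an isomorphism, while `e` is already epi for presheaves of abelian groups.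
  have hφ : φ = inv (adj.counit.app M) ≫ a.map e ≫ a.map m ≫ adj.counit.app N := by
    rw [IsIso.eq_inv_comp, ← a.map_comp_assoc, image.fac]
    exact (adj.counit_naturality φ).symm
  have h₁ : Epi (a.map m ≫ adj.counit.app N) := by
    have h := ‹Epi φ›
    rw [hφ, ← Category.assoc] at h
    exact @epi_of_epi _ _ _ _ _ _ _ h
  have h₂ : Epi (a.map m) := by
    have := epi_comp (a.map m ≫ adj.counit.app N) (inv (adj.counit.app N))
    simpa using this
  have h₃ : IsIso (a.map m) := isIso_of_mono_of_epi _
  have : Epi ((PresheafOfModules.toPresheaf R.obj).map e) := by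
    have : Epi e := inferInstanceAs (Epi (factorThruImage (G.map φ)))
    exact (PresheafOfModules.toPresheaf R.obj).map_epi e
  have h₄ : Epi ((SheafOfModules.toSheaf R).map (a.map e)) :=
    inferInstanceAs (Epi ((presheafToSheaf J AddCommGrpCat).map
      ((PresheafOfModules.toPresheaf _).map e)))
  rw [hφ]
  simp only [Functor.map_comp]
  infer_instance

instance {A B : Type u} (R : RingCat.{u}) (f : A ⟶ B) [Mono f] :
    Mono ((ModuleCat.free R).map f) := by
  rw [ModuleCat.mono_iff_injective]
  exact Finsupp.mapDomain_injective ((mono_iff_injective f).1 inferInstance)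

/-- Free modules and sheafification both preserve monomorphisms. This is what makes injective
modules flasque. -/
instance {U V : C} (i : V ⟶ U) [Mono i] : Mono ((freeYonedaSheaf R).map i) := by
  have : Mono ((PresheafOfModules.free R.obj).map (yoneda.map i)) := by
    apply PresheafOfModules.mono_of_injective
    intro W
    rw [← ModuleCat.mono_iff_injective]
    have : Mono ((yoneda.map i).app W) := inferInstance
    exact inferInstanceAs (Mono ((ModuleCat.free (R.obj.obj W)).map ((yoneda.map i).app W)))
  exact inferInstanceAs (Mono ((PresheafOfModules.sheafification (𝟙 R.obj)).map
    ((PresheafOfModules.free R.obj).map (yoneda.map i))))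

end FreeYonedaSheaf

/-! ### Sections over opens, and generators from affine opens. -/

section FreeOnOpen

variable {X : Scheme.{u}}

/-- The restriction of sections of an `𝒪_X`-module. -/
def res (F : X.Modules) {U V : X.Opens} (h : V ≤ U) : Γ(F, U) →+ Γ(F, V) :=
  (F.presheaf.map (homOfLE h).op).hom

@[simp]
lemma res_res (F : X.Modules) {U V W : X.Opens} (h : V ≤ U) (h' : W ≤ V) (x : Γ(F, U)) :
    res F h' (res F h x) = res F (h'.trans h) x := by
  dsimp only [res]
  rw [← AddCommGrpCat.comp_apply, ← F.presheaf.map_comp]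
  rfl

lemma res_self (F : X.Modules) {U : X.Opens} (h : U ≤ U) (x : Γ(F, U)) : res F h x = x :=
  ConcreteCategory.congr_hom (F.presheaf.map_id (.op U)) x

lemma app_res {F F' : X.Modules} (φ : F ⟶ F') {U V : X.Opens} (h : V ≤ U) (x : Γ(F, U)) :
    φ.app V (res F h x) = res F' h (φ.app U x) :=
  NatTrans.naturality_apply φ.mapPresheaf (homOfLE h).op x

lemma eq_of_res_eq (F : X.Modules) {U : X.Opens} (x y : Γ(F, U))
    (h : ∀ a ∈ U, ∃ (V : X.Opens) (hV : V ≤ U), a ∈ V ∧ res F hV x = res F hV y) : x = y := by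
  choose V hV ha hx using fun a : U => h a.1 a.2
  exact TopCat.Sheaf.eq_of_locally_eq' ⟨F.presheaf, F.isSheaf⟩ V U (fun a => homOfLE (hV a))
    (fun a haU => TopologicalSpace.Opens.mem_iSup.2 ⟨⟨a, haU⟩, ha _⟩) x y hx

lemma exists_glue (F : X.Modules) {U V₁ V₂ W : X.Opens} (h₁ : V₁ ≤ U) (h₂ : V₂ ≤ U)
    (hU : U ≤ V₁ ⊔ V₂) (hW : W = V₁ ⊓ V₂) (x₁ : Γ(F, V₁)) (x₂ : Γ(F, V₂))
    (h : res F (show W ≤ V₁ from hW.trans_le inf_le_left) x₁ =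
      res F (show W ≤ V₂ from hW.trans_le inf_le_right) x₂) :
    ∃ x : Γ(F, U), res F h₁ x = x₁ ∧ res F h₂ x = x₂ := by
  obtain rfl := hW
  obtain ⟨x, hx, -⟩ := TopCat.Sheaf.existsUnique_gluing' ⟨F.presheaf, F.isSheaf⟩
    (fun b : Bool => if b then V₁ else V₂) U
    (fun b => homOfLE (by cases b <;> assumption))
    (fun a ha => TopologicalSpace.Opens.mem_iSup.2 ((hU ha).elim (fun h => ⟨true, h⟩)
      (fun h => ⟨false, h⟩)))
    (fun b => match b with
      | true => x₁
      | false => x₂) (by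
      rintro (_ | _) (_ | _)
      · rfl
      · have h' := congr_arg (res F (show V₂ ⊓ V₁ ≤ V₁ ⊓ V₂ from (inf_comm V₂ V₁).le)) h.symm
        rwa [res_res, res_res] at h'
      · exact h
      · rfl)
  exact ⟨x, hx true, hx false⟩

lemma exists_locally_eq_app {F F' : X.Modules} (φ : F ⟶ F') [Epi φ] {U : X.Opens}
    (x : Γ(F', U)) (a : X) (ha : a ∈ U) :
    ∃ (V : X.Opens) (hV : V ≤ U) (y : Γ(F, V)), a ∈ V ∧ φ.app V y = res F' hV x := by
  have h : Epi ((SheafOfModules.toSheaf X.ringCatSheaf).map φ) := by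
    have : Epi (C := SheafOfModules X.ringCatSheaf) φ := ‹_›
    exact epi_toSheaf_map _
  have h' := (TopCat.Sheaf.isLocallySurjective_iff_epi
    (F := ⟨F.presheaf, F.isSheaf⟩) (G := ⟨F'.presheaf, F'.isSheaf⟩) ⟨φ.mapPresheaf⟩).2 h
  rw [TopCat.Presheaf.isLocallySurjective_iff] at h'
  obtain ⟨V, hV, ⟨y, hy⟩, haV⟩ := h' U x a ha
  exact ⟨V, hV, y, haV, hy⟩

variable (X) in
/-- The functor which sends `U` to the extension by zero of `𝒪_U`, which represents the functor
of sections over `U`. -/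
def freeOn : X.Opens ⥤ X.Modules := freeYonedaSheaf X.ringCatSheaf

/-- Morphisms from `freeOn U` to `F` are sections of `F` over `U`. -/
def freeOnEquiv (U : X.Opens) (F : X.Modules) : ((freeOn X).obj U ⟶ F) ≃ Γ(F, U) :=
  freeYonedaSheafEquiv U F

lemma freeOnEquiv_comp {U : X.Opens} {F F' : X.Modules} (f : (freeOn X).obj U ⟶ F) (φ : F ⟶ F') :
    freeOnEquiv U F' (f ≫ φ) = φ.app U (freeOnEquiv U F f) :=
  freeYonedaSheafEquiv_comp f φ

@[simp]
lemma freeOnEquiv_zero (U : X.Opens) (F : X.Modules) : freeOnEquiv U F 0 = 0 := by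
  rw [← comp_zero (f := (0 : (freeOn X).obj U ⟶ F)), freeOnEquiv_comp]
  rfl

lemma freeOnEquiv_map_comp {U V : X.Opens} (i : V ⟶ U) {F : X.Modules}
    (f : (freeOn X).obj U ⟶ F) :
    freeOnEquiv V F ((freeOn X).map i ≫ f) = F.presheaf.map i.op (freeOnEquiv U F f) :=
  freeYonedaSheafEquiv_map_comp i f

instance {U V : X.Opens} (i : V ⟶ U) : Mono ((freeOn X).map i) :=
  inferInstanceAs (Mono ((freeYonedaSheaf X.ringCatSheaf).map i))

/-- Injective `𝒪_X`-modules are flasque. -/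
lemma exists_restrict_eq_of_injective (E : X.Modules) [Injective E] {U V : X.Opens} (i : V ⟶ U)
    (x : Γ(E, V)) : ∃ y : Γ(E, U), E.presheaf.map i.op y = x :=
  ⟨freeOnEquiv U E (Injective.factorThru ((freeOnEquiv V E).symm x) ((freeOn X).map i)), by
    rw [← freeOnEquiv_map_comp, Injective.comp_factorThru, Equiv.apply_symm_apply]⟩

/-- A complex of `𝒪_X`-modules whose sections over `U` are exact in degree `j`. -/
lemma isHomExact_freeOn_iff (U : X.Opens) (L : CochainComplex X.Modules ℤ) :
    IsHomExact ((freeOn X).obj U) L ↔ ∀ i j k : ℤ, i + 1 = j → j + 1 = k → 1 ≤ j →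
      ∀ x : Γ(L.X j, U), (L.d j k).app U x = 0 → ∃ y : Γ(L.X i, U), (L.d i j).app U y = x := by
  refine forall₅_congr fun i j k hij hjk => forall_congr' fun hj => ?_
  rw [(freeOnEquiv U (L.X j)).forall_congr_left]
  refine forall_congr' fun x => ?_
  refine imp_congr ?_ ?_
  · rw [← (freeOnEquiv U (L.X k)).apply_eq_iff_eq, freeOnEquiv_comp, freeOnEquiv_zero,
      Equiv.apply_symm_apply]
  · rw [(freeOnEquiv U (L.X i)).exists_congr_left]
    refine exists_congr fun y => ?_
    rw [← (freeOnEquiv U (L.X j)).apply_eq_iff_eq, freeOnEquiv_comp, Equiv.apply_symm_apply,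
      Equiv.apply_symm_apply]

lemma isHomExact_sigma {C : Type u} [Category.{v} C] [Abelian C] {ι : Type*} (G : ι → C)
    [HasCoproduct G] {L : CochainComplex C ℤ} (hG : ∀ i, IsHomExact (G i) L) :
    IsHomExact (∐ G) L := by
  intro i j k hij hjk hj x hx
  choose y hy using fun a => hG a i j k hij hjk hj (Sigma.ι G a ≫ x) (by
    rw [Category.assoc, hx, comp_zero])
  refine ⟨Sigma.desc y, Sigma.hom_ext _ _ fun a => ?_⟩
  rw [Sigma.ι_desc_assoc, hy]

/-- Every `𝒪_X`-module is a quotient of a sum of sheaves `freeOn U` with `U` affine. -/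
lemma exists_epi_sigma_freeOn (F : X.Modules) :
    ∃ (ι : Type u) (U : ι → X.affineOpens) (π : (∐ fun i => (freeOn X).obj (U i)) ⟶ F), Epi π := by
  -- One summand for every section over every affine open; a morphism killing all of them is zero
  -- because affine opens form a basis.
  refine ⟨Σ U : X.affineOpens, Γ(F, U), fun i => i.1,
    Sigma.desc fun i => (freeOnEquiv _ F).symm i.2, ?_⟩
  rw [Preadditive.epi_iff_cancel_zero]
  intro F' g hg
  have key (U : X.affineOpens) (x : Γ(F, U)) : g.app U x = 0 := by
    have h := Sigma.ι (fun i : Σ U : X.affineOpens, Γ(F, U) => (freeOn X).obj i.1) ⟨U, x⟩ ≫= hg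
    rw [Sigma.ι_desc_assoc, comp_zero] at h
    have h' := freeOnEquiv_comp ((freeOnEquiv _ F).symm x) g
    rw [h, Equiv.apply_symm_apply] at h'
    rw [← h', freeOnEquiv_zero]
  ext U x
  refine eq_of_res_eq F' _ _ fun a ha => ?_
  obtain ⟨V, hV, haV, hVU⟩ := (TopologicalSpace.Opens.isBasis_iff_nbhd.1 X.isBasis_affineOpens) ha
  exact ⟨V, hVU, haV, by rw [← app_res, key ⟨V, hV⟩]; simp⟩

end FreeOnOpen

end

end CartanEilenberg

namespace CartanEilenberg

/-! ### Reduction to covers by two basic opens. -/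

section Cover

/-- Induction on affine covers: a property of open subsets, which is inherited by smaller open
subsets, holds for an affine open subset if it holds locally, provided that it may be checked
on covers of an affine open subset by two complementary basic open subsets. -/
lemma affine_cover_induction {X : Scheme.{u}} (P : X.Opens → Prop) (hbot : P ⊥)
    (hmono : ∀ U V : X.Opens, V ≤ U → P U → P V)
    (htwo : ∀ (U : X.Opens) (f g : Γ(X, U)), IsAffineOpen U → f + g = 1 →
      P (X.basicOpen f) → P (X.basicOpen g) → P U)
    {U : X.Opens} (hU : IsAffineOpen U) (hloc : ∀ a ∈ U, ∃ V : X.Opens, a ∈ V ∧ P V) : P U := by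
  have key {ι : Type u} (s : Finset ι) : ∀ (U : X.Opens), IsAffineOpen U →
      ∀ (f c : ι → Γ(X, U)), ∑ i ∈ s, c i * f i = 1 → (∀ i ∈ s, P (X.basicOpen (f i))) → P U := by
    classical
    induction s using Finset.induction with
    | empty =>
      intro U hU f c h _
      refine hmono ⊥ U ?_ hbot
      rw [← X.basicOpen_zero U, show (0 : Γ(X, U)) = 1 from h]
      exact (X.basicOpen_of_isUnit isUnit_one).ge
    | insert i s hi ih =>
      intro U hU f c h hP
      rw [Finset.sum_insert hi] at h
      refine htwo U _ _ hU h (hmono _ _ ?_ (hP i (by simp))) ?_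
      · rw [X.basicOpen_mul]
        exact inf_le_right
      -- On the basic open of `r` this sum is invertible; dividing the coefficients by it yields a
      -- partition of unity with one term fewer.
      · let r := ∑ j ∈ s, c j * f j
        have hr : IsUnit (X.presheaf.map (homOfLE (X.basicOpen_le r)).op r) :=
          RingedSpace.isUnit_res_basicOpen _ r
        obtain ⟨w, hw⟩ := hr.exists_left_inv
        refine ih _ (hU.basicOpen r) (fun j => X.presheaf.map (homOfLE (X.basicOpen_le r)).op (f j))
          (fun j => w * X.presheaf.map (homOfLE (X.basicOpen_le r)).op (c j)) ?_ ?_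
        · simp only [mul_assoc, ← Finset.mul_sum, ← map_mul, ← map_sum]
          exact hw
        · intro j hj
          refine hmono _ _ ?_ (hP j (by simp [hj]))
          rw [Scheme.basicOpen_res]
          exact inf_le_right
  choose V hV hPV using fun a : U => hloc a.1 a.2
  choose f hf hf' using fun a : U => hU.exists_basicOpen_le ⟨a.1, hV a⟩ a.2
  have hspan : Ideal.span (Set.range f) = ⊤ := by
    rw [← hU.iSup_basicOpen_eq_self_iff]
    refine le_antisymm (iSup_le fun a => X.basicOpen_le _) fun a ha => ?_
    exact TopologicalSpace.Opens.mem_iSup.2 ⟨⟨_, ⟨⟨a, ha⟩, rfl⟩⟩, hf' ⟨a, ha⟩⟩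
  obtain ⟨s, hs, hs'⟩ := (Ideal.span_eq_top_iff_finite _).1 hspan
  obtain ⟨c, -, hc⟩ := Submodule.mem_span_finset.1 ((Ideal.eq_top_iff_one _).1 hs')
  refine key s U hU id c hc fun r hr => ?_
  obtain ⟨a, rfl⟩ := hs hr
  exact hmono _ _ (hf a) (hPV a)

end Cover

/-! ### Čech vanishing for quasi-coherent modules and two basic opens. -/

section Quasicoherent

variable {R : CommRingCat.{u}} (N : (Spec R).Modules)

lemma res_smul {U V : (Spec R).Opens} (h : V ≤ U) (r : R) (x : Γ(N, U)) :
    res N h (r • x) = r • res N h x :=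
  Scheme.Modules.map_smul_Spec _ _ _

/-- Sections of a quasi-coherent module over `D(r)` are the localization at `r` of its global
sections. -/
lemma exists_pow_smul_eq_res [N.IsQuasicoherent] {U : (Spec R).Opens} {r : R}
    (hU : U = PrimeSpectrum.basicOpen r) (n : Γ(N, U)) :
    ∃ (k : ℕ) (a : Γ(N, ⊤)), r ^ k • n = res N le_top a := by
  subst hU
  obtain ⟨⟨a, ⟨_, k, rfl⟩⟩, ha⟩ :=
    ((isIso_fromTildeΓ_iff_isLocalizing N).1 inferInstance r).surj n
  exact ⟨k, a, ha⟩

lemma bijective_pow_smul {U : (Spec R).Opens} {r : R}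
    (hU : U ≤ PrimeSpectrum.basicOpen r) (k : ℕ) :
    Function.Bijective fun n : Γ(N, U) => r ^ k • n := by
  have := (N.isUnit_algebraMap_end_of_le_basicOpen r hU).pow k
  rwa [← map_pow, Module.End.isUnit_iff] at this

/-- Clear denominators: `(fg)^k n` extends to a global `a`. Then `a / f^k` and `a / g^k` restrict to
`g^k n` and `f^k n`, and a relation `u f^k + v g^k = 1` recombines them to `n`. -/
lemma exists_eq_add_of_isQuasicoherent_Spec [N.IsQuasicoherent] {f g : R} (h : f + g = 1)
    {U V W : (Spec R).Opens} (hU : U = PrimeSpectrum.basicOpen f)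
    (hV : V = PrimeSpectrum.basicOpen g) (hW : W = PrimeSpectrum.basicOpen (f * g))
    (hWU : W ≤ U) (hWV : W ≤ V) (n : Γ(N, W)) :
    ∃ (n₁ : Γ(N, U)) (n₂ : Γ(N, V)), n = res N hWU n₁ + res N hWV n₂ := by
  obtain ⟨k, a, ha⟩ := exists_pow_smul_eq_res N hW n
  obtain ⟨y₁, hy₁⟩ := (bijective_pow_smul N hU.le k).surjective (res N le_top a)
  obtain ⟨y₂, hy₂⟩ := (bijective_pow_smul N hV.le k).surjective (res N le_top a)
  dsimp only at hy₁ hy₂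
  have e₁ : res N hWU y₁ = g ^ k • n := by
    apply (bijective_pow_smul N (hWU.trans hU.le) k).injective
    dsimp only
    rw [← res_smul, hy₁, res_res, ← ha, smul_smul, mul_pow]
  have e₂ : res N hWV y₂ = f ^ k • n := by
    apply (bijective_pow_smul N (hWV.trans hV.le) k).injective
    dsimp only
    rw [← res_smul, hy₂, res_res, ← ha, smul_smul, mul_pow, mul_comm]
  obtain ⟨u, v, huv⟩ := (show IsCoprime f g from ⟨1, 1, by simpa⟩).pow (m := k) (n := k)
  refine ⟨v • y₁, u • y₂, ?_⟩
  rw [res_smul, res_smul, e₁, e₂, smul_smul, smul_smul, ← add_smul, add_comm, huv, one_smul]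

lemma exists_eq_add_of_isQuasicoherent {X : Scheme.{u}} (M : X.Modules) [M.IsQuasicoherent]
    {U : X.Opens} (hU : IsAffineOpen U) {f g : Γ(X, U)} (h : f + g = 1) {W : X.Opens}
    (hf : W ≤ X.basicOpen f) (hg : W ≤ X.basicOpen g) (hW : W = X.basicOpen f ⊓ X.basicOpen g)
    (m : Γ(M, W)) :
    ∃ (m₁ : Γ(M, X.basicOpen f)) (m₂ : Γ(M, X.basicOpen g)), m = res M hf m₁ + res M hg m₂ := by
  let j := hU.fromSpec
  let D (r : Γ(X, U)) : (Spec Γ(X, U)).Opens := PrimeSpectrum.basicOpen r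
  have hD (r : Γ(X, U)) : j ''ᵁ D r = X.basicOpen r := hU.fromSpec_image_basicOpen r
  have hfg : D (f * g) = D f ⊓ D g := PrimeSpectrum.basicOpen_mul f g
  have hW' : W = j ''ᵁ D (f * g) := by rw [hD, X.basicOpen_mul, hW]
  obtain ⟨n₁, n₂, hn⟩ := exists_eq_add_of_isQuasicoherent_Spec (M.restrict j) h
    (U := D f) (V := D g) (W := D (f * g)) rfl rfl rfl
    (hfg.trans_le inf_le_left) (hfg.trans_le inf_le_right) (res M hW'.ge m)
  refine ⟨res M (hD f).ge n₁, res M (hD g).ge n₂, ?_⟩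
  have e := congr_arg (res M hW'.le) hn
  refine (res_self M le_rfl m).symm.trans ((res_res M _ _ m).symm.trans
    (e.trans ((map_add (res M hW'.le) _ _).trans ?_)))
  exact congr_arg₂ (· + ·) ((res_res M _ _ n₁).trans (res_res M _ _ n₁).symm)
    ((res_res M _ _ n₂).trans (res_res M _ _ n₂).symm)

end Quasicoherent

/-! ### Vanishing of higher cohomology on affine opens. -/

section Vanishing

variable {X : Scheme.{u}}

lemma exists_locally_eq_d {L : CochainComplex X.Modules ℤ} {i j k : ℤ} (hij : i + 1 = j)
    (hjk : j + 1 = k) (hL : L.ExactAt j) {U : X.Opens} (x : Γ(L.X j, U))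
    (hx : (L.d j k).app U x = 0) (a : X) (ha : a ∈ U) :
    ∃ (V : X.Opens) (hV : V ≤ U) (y : Γ(L.X i, V)), a ∈ V ∧
      (L.d i j).app V y = res (L.X j) hV x := by
  rw [L.exactAt_iff' i j k (by simp; lia) (by simp; lia)] at hL
  have hx' : (freeOnEquiv U (L.X j)).symm x ≫ L.d j k = 0 := by
    apply (freeOnEquiv U _).injective
    rw [freeOnEquiv_comp, Equiv.apply_symm_apply, hx, freeOnEquiv_zero]
  obtain ⟨A, π, hπ, y, hy⟩ := hL.exact_up_to_refinements _ hx'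
  -- Lifting the universal section of `freeOn U` locally turns the refinement `π` into a smaller
  -- open set.
  obtain ⟨V, hV, z, haV, hz⟩ := exists_locally_eq_app π (freeOnEquiv U _ (𝟙 _)) a ha
  refine ⟨V, hV, y.app V z, haV, ?_⟩
  have h₁ := ConcreteCategory.congr_hom (congr_arg (Scheme.Modules.Hom.app · V) hy) z
  have h₂ : (L.d i j).app V (y.app V z) =
    ((freeOnEquiv U (L.X j)).symm x).app V (π.app V z) := h₁.symm
  rw [h₂, hz, app_res, ← freeOnEquiv_comp, Category.id_comp, Equiv.apply_symm_apply]

/-- The Mayer–Vietoris argument: a complex of sheaves which is exact in degree `j` has exact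
sections over affine open subsets if cocycles of degree `i = j - 1` on an intersection of
complementary basic open subsets decompose. -/
lemma exists_d_app_eq_of_split {L : CochainComplex X.Modules ℤ} {i j k : ℤ} (hij : i + 1 = j)
    (hjk : j + 1 = k) (hL : L.ExactAt j)
    (hsplit : ∀ (U : X.Opens) (f g : Γ(X, U)), IsAffineOpen U → f + g = 1 →
      ∀ u : Γ(L.X i, X.basicOpen f ⊓ X.basicOpen g), (L.d i j).app _ u = 0 →
        ∃ (u₁ : Γ(L.X i, X.basicOpen f)) (u₂ : Γ(L.X i, X.basicOpen g)),
          (L.d i j).app _ u₁ = 0 ∧ (L.d i j).app _ u₂ = 0 ∧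
            u = res _ inf_le_left u₁ + res _ inf_le_right u₂)
    {U : X.Opens} (hU : IsAffineOpen U) (x : Γ(L.X j, U)) (hx : (L.d j k).app U x = 0) :
    ∃ y : Γ(L.X i, U), (L.d i j).app U y = x := by
  obtain ⟨_, y, hy⟩ := affine_cover_induction
    (fun V => ∃ (hV : V ≤ U) (y : Γ(L.X i, V)), (L.d i j).app V y = res (L.X j) hV x)
    ⟨bot_le, 0, eq_of_res_eq _ _ _ fun a ha => ha.elim⟩
    (fun V W hWV ⟨hV, y, hy⟩ => ⟨hWV.trans hV, res _ hWV y, by rw [app_res, hy, res_res]⟩)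
    (fun V f g hV hfg ⟨hf, y₁, hy₁⟩ ⟨hg, y₂, hy₂⟩ => by
      have hcov : V ≤ X.basicOpen f ⊔ X.basicOpen g := by
        have h := (hV.iSup_basicOpen_eq_self_iff (s := {f, g})).2 (by
          rw [Ideal.eq_top_iff_one, ← hfg]
          exact add_mem (Ideal.subset_span (by simp)) (Ideal.subset_span (by simp)))
        rw [iSup_subtype, iSup_pair] at h
        exact h.ge
      -- The two primitives differ on the overlap by a cocycle; splitting it into cocycles on the
      -- two opens corrects the primitives so that they glue.
      obtain ⟨u₁, u₂, hu₁, hu₂, hu⟩ := hsplit V f g hV hfg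
        (res _ inf_le_left y₁ - res _ inf_le_right y₂) (by
          rw [map_sub, app_res, app_res, hy₁, hy₂, res_res, res_res, sub_self])
      obtain ⟨y, h₁, h₂⟩ := exists_glue (L.X i) (X.basicOpen_le f) (X.basicOpen_le g) hcov rfl
        (y₁ - u₁) (y₂ + u₂) (by
          rw [map_sub, map_add, sub_eq_iff_eq_add]
          rw [sub_eq_iff_eq_add] at hu
          rw [hu]
          abel)
      refine ⟨hcov.trans (sup_le hf hg), y, eq_of_res_eq _ _ _ fun a ha => ?_⟩
      rcases hcov ha with h | h
      · refine ⟨_, X.basicOpen_le f, h, ?_⟩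
        rw [← app_res, h₁, map_sub, hu₁, sub_zero, hy₁, res_res]
      · refine ⟨_, X.basicOpen_le g, h, ?_⟩
        rw [← app_res, h₂, map_add, hu₂, add_zero, hy₂, res_res])
    hU (fun a ha => by
      obtain ⟨V, hV, y, haV, hy⟩ := exists_locally_eq_d hij hjk hL x hx a ha
      exact ⟨V, haV, hV, y, hy⟩)
  exact ⟨y, hy.trans (res_self _ _ _)⟩

/-- Quasi-coherent modules have no higher cohomology on affine open subsets. -/
lemma exists_d_app_eq {M : X.Modules} [M.IsQuasicoherent] {L : CochainComplex X.Modules ℤ}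
    {a : (HomologicalComplex.single X.Modules (ComplexShape.up ℤ) 0).obj M ⟶ L}
    (ha : IsInjectiveResolution a) (n : ℕ) : ∀ (i j k : ℤ), i = n → i + 1 = j → j + 1 = k →
      ∀ (U : X.Opens), IsAffineOpen U → ∀ x : Γ(L.X j, U), (L.d j k).app U x = 0 →
        ∃ y : Γ(L.X i, U), (L.d i j).app U y = x := by
  have hd {F F' F'' : X.Modules} (φ : F ⟶ F') (ψ : F' ⟶ F'') (h : φ ≫ ψ = 0) {U : X.Opens}
      (x : Γ(F, U)) : ψ.app U (φ.app U x) = 0 :=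
    ConcreteCategory.congr_hom (congr_arg (Scheme.Modules.Hom.app · U) h) x
  induction n with
  | zero =>
    intro i j k hi hij hjk U hU x hx
    obtain rfl : i = 0 := by simpa using hi
    obtain rfl : j = 1 := by lia
    refine exists_d_app_eq_of_split hij hjk (ha.exactAt (by lia)) ?_ hU x hx
    intro V f g hV hfg u hu
    -- A cocycle of degree `0` is a section of `M`; only here is quasi-coherence used.
    obtain ⟨m, hm⟩ := ha.exists_lift ((freeOnEquiv _ _).symm u) (by
      apply (freeOnEquiv _ _).injective
      rw [freeOnEquiv_comp, Equiv.apply_symm_apply, hu, freeOnEquiv_zero])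
    obtain ⟨m₁, m₂, hm'⟩ := exists_eq_add_of_isQuasicoherent M hV hfg inf_le_left inf_le_right rfl
      (freeOnEquiv _ _ m)
    refine ⟨_, _, hd _ _ (IsInjectiveResolution.comp_d a) m₁,
      hd _ _ (IsInjectiveResolution.comp_d a) m₂, ?_⟩
    rw [← app_res, ← app_res, ← map_add, ← hm', ← freeOnEquiv_comp, hm, Equiv.apply_symm_apply]
  | succ n ih =>
    intro i j k hi hij hjk U hU x hx
    refine exists_d_app_eq_of_split hij hjk (ha.exactAt (by lia)) ?_ hU x hx
    intro V f g hV hfg u hu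
    have hW : IsAffineOpen (X.basicOpen f ⊓ X.basicOpen g) := by
      rw [← X.basicOpen_mul]
      exact hV.basicOpen _
    -- The overlap is affine, so `u` has a primitive there by induction. It extends to the first
    -- open by flasqueness, and the differential of the extension, together with `0`, splits `u`.
    obtain ⟨w, hw⟩ := ih (i - 1) i j (by push_cast at hi; lia) (by lia) hij _ hW u hu
    have := ha.injective (i - 1)
    obtain ⟨w', hw'⟩ := exists_restrict_eq_of_injective (L.X (i - 1))
      (homOfLE (inf_le_left : X.basicOpen f ⊓ X.basicOpen g ≤ _)) w
    have hw' : res _ inf_le_left w' = w := hw'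
    refine ⟨(L.d (i - 1) i).app _ w', 0, hd _ _ (L.d_comp_d _ _ _) w', map_zero _, ?_⟩
    rw [← app_res, hw', hw, map_zero, add_zero]

lemma isHomExact_freeOn {M : X.Modules} [M.IsQuasicoherent] {L : CochainComplex X.Modules ℤ}
    {a : (HomologicalComplex.single X.Modules (ComplexShape.up ℤ) 0).obj M ⟶ L}
    (ha : IsInjectiveResolution a) (U : X.affineOpens) : IsHomExact ((freeOn X).obj U) L := by
  rw [isHomExact_freeOn_iff]
  intro i j k hij hjk hj x hx
  exact exists_d_app_eq ha i.toNat i j k (by lia) hij hjk U U.2 x hx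

end Vanishing

end CartanEilenberg

namespace CartanEilenberg

universe v₁ v₂ u₁ u₂

/-! ### The derived functor computed by a K-injective complex. -/

section DerivedFunctor

variable {C : Type u₁} [Category.{v₁} C] [Abelian C] [HasDerivedCategory.{w₁} C]
  {D : Type u₂} [Category.{v₂} D] [Abelian D] [HasDerivedCategory.{w₂} D]

/-- A K-injective complex `J` isomorphic to `K` in the derived category is a terminal object
in the category of complexes up to homotopy over `K`. -/
noncomputable def isTerminalOfIsKInjective {K J : CochainComplex C ℤ} [J.IsKInjective]
    (i : DerivedCategory.Qh.obj ((HomotopyCategory.quotient C (ComplexShape.up ℤ)).obj J) ⟶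
      DerivedCategory.Qh.obj ((HomotopyCategory.quotient C (ComplexShape.up ℤ)).obj K)) [IsIso i] :
    IsTerminal (CostructuredArrow.mk i) := by
  have h (Y : CostructuredArrow DerivedCategory.Qh
      (DerivedCategory.Qh.obj ((HomotopyCategory.quotient C (ComplexShape.up ℤ)).obj K))) :
      -- Morphisms into a K-injective complex are the same up to homotopy and in the derived
      -- category: surjectivity gives existence, injectivity uniqueness.
      Function.Bijective (DerivedCategory.Qh.map : (Y.left ⟶ _) → _) :=
    CochainComplex.IsKInjective.Qh_map_bijective Y.left J
  choose g hg using fun Y => (h Y).surjective (Y.hom ≫ inv i)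
  let t (Y) : Y ⟶ CostructuredArrow.mk i := CostructuredArrow.homMk (g Y) (by simp [hg])
  refine IsTerminal.ofUniqueHom t fun Y m => ?_
  ext
  apply (h Y).injective
  change DerivedCategory.Qh.map m.left = DerivedCategory.Qh.map (g Y)
  have := CostructuredArrow.w m
  simp only [CostructuredArrow.mk_hom_eq_self] at this
  rw [hg, ← this]
  simp

variable (F : C ⥤ D) [F.Additive] {K J : CochainComplex C ℤ} (η : K ⟶ J)

/-- The defining colimit runs over a category with terminal object `J`, so it exists; it is attained
at `J`, whence the next lemma. -/
lemma hasRightDerivedAt_of_isKInjective [J.IsKInjective] [QuasiIso η] : HasRightDerivedAt F K := by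
  rw [HasRightDerivedAt, Functor.hasPointwiseRightDerivedFunctorAt_iff _ DerivedCategory.Qh]
  have := (isTerminalOfIsKInjective ((DerivedCategory.quotientCompQhIso C).hom.app J ≫
    inv (DerivedCategory.Q.map η) ≫ (DerivedCategory.quotientCompQhIso C).inv.app K)).hasTerminal
  infer_instance

lemma isIso_toRightDerivedAt [J.IsKInjective] [QuasiIso η] [HasRightDerivedAt F K] :
    IsIso (toRightDerivedAt F η) := by
  have := Functor.HasPointwiseRightDerivedFunctorAt.hasColimit (homotopyToDerived F)
    DerivedCategory.Qh (HomotopyCategory.quasiIso C (ComplexShape.up ℤ))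
    ((HomotopyCategory.quotient _ _).obj K)
  exact isIso_ι_of_isTerminal (isTerminalOfIsKInjective
    ((DerivedCategory.quotientCompQhIso C).hom.app J ≫ inv (DerivedCategory.Q.map η) ≫
      (DerivedCategory.quotientCompQhIso C).inv.app K)) _

end DerivedFunctor

/-! ### Comparison with an arbitrary K-injective resolution. -/

section Comparison

variable {C : Type u₁} [Category.{v₁} C] [Abelian C] {K J L : CochainComplex C ℤ}

/-- Precomposition with a quasi-isomorphism is bijective on homotopy classes of morphisms
to a K-injective complex. -/
lemma bijective_quotient_map_comp [L.IsKInjective] (η : K ⟶ J) [QuasiIso η] :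
    Function.Bijective fun φ : (HomotopyCategory.quotient C (ComplexShape.up ℤ)).obj J ⟶
        (HomotopyCategory.quotient C (ComplexShape.up ℤ)).obj L =>
      (HomotopyCategory.quotient C (ComplexShape.up ℤ)).map η ≫ φ := by
  let := HasDerivedCategory.standard C
  let q := HomotopyCategory.quotient C (ComplexShape.up ℤ)
  have hη : IsIso (DerivedCategory.Qh.map (q.map η)) := by
    have := NatIso.naturality_2 (DerivedCategory.quotientCompQhIso C) η
    dsimp at this
    rw [← this]
    infer_instance
  have hJ := CochainComplex.IsKInjective.Qh_map_bijective (q.obj J) L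
  have hK := CochainComplex.IsKInjective.Qh_map_bijective (q.obj K) L
  constructor
  · intro φ ψ h
    apply hJ.injective
    rw [← cancel_epi (DerivedCategory.Qh.map (q.map η)), ← Functor.map_comp, ← Functor.map_comp]
    exact congr_arg _ h
  · intro ψ
    obtain ⟨φ, hφ⟩ := hJ.surjective (inv (DerivedCategory.Qh.map (q.map η)) ≫
      DerivedCategory.Qh.map ψ)
    exact ⟨φ, hK.injective (by simp [hφ, q])⟩

lemma exists_comparison [J.IsKInjective] [L.IsKInjective] (η : K ⟶ J) [QuasiIso η] (s : K ⟶ L)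
    [QuasiIso s] :
    ∃ φ : J ⟶ L, Nonempty (Homotopy (η ≫ φ) s) ∧
      (∀ φ' : J ⟶ L, Nonempty (Homotopy (η ≫ φ') s) → Nonempty (Homotopy φ' φ)) ∧
      HomologicalComplex.homotopyEquivalences C (ComplexShape.up ℤ) φ := by
  let q := HomotopyCategory.quotient C (ComplexShape.up ℤ)
  have hη := bijective_quotient_map_comp (L := L) η
  obtain ⟨φ, hφ⟩ := hη.surjective (q.map s)
  obtain ⟨φ, rfl⟩ := q.map_surjective φ
  have h : Homotopy (η ≫ φ) s := HomotopyCategory.homotopyOfEq _ _ (by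
    rw [Functor.map_comp]; exact hφ)
  refine ⟨φ, ⟨h⟩, ?_, ?_⟩
  · rintro φ' ⟨h'⟩
    refine ⟨HomotopyCategory.homotopyOfEq _ _ (hη.injective ?_)⟩
    have := HomotopyCategory.eq_of_homotopy _ _ h'
    rw [Functor.map_comp] at this
    exact this.trans hφ.symm
  -- Between K-injective complexes a quasi-isomorphism is a homotopy equivalence, a property which
  -- every additive functor preserves.
  · rw [← CochainComplex.IsKInjective.quasiIso_iff]
    have : QuasiIso (η ≫ φ) := by
      refine (quasiIso_iff _).2 fun n => ?_
      rw [quasiIsoAt_iff_isIso_homologyMap, h.homologyMap_eq n]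
      infer_instance
    exact quasiIso_of_comp_left η φ

lemma isIso_homologyMap_of_homotopyEquivalences {D : Type u₂} [Category.{v₂} D] [Abelian D]
    (F : C ⥤ D) [F.Additive] {φ : J ⟶ L}
    (hφ : HomologicalComplex.homotopyEquivalences C (ComplexShape.up ℤ) φ) (n : ℤ) :
    IsIso (HomologicalComplex.homologyMap
      ((F.mapHomologicalComplex (ComplexShape.up ℤ)).map φ) n) := by
  obtain ⟨e, rfl⟩ := hφ
  exact ((F.mapHomotopyEquiv e).toHomologyIso n).isIso_hom

end Comparison

/-- The choice of generators does not depend on `p`: affine opens are acyclic for all the `H^p K`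
simultaneously. -/
lemma IsCartanEilenbergResolution.quasiIso_of_isQuasicoherent {X : Scheme.{u}}
    {K : CochainComplex X.Modules ℤ} {I : CochainComplex (CochainComplex X.Modules ℤ) ℤ}
    {ε : (HomologicalComplex.single (CochainComplex X.Modules ℤ) (ComplexShape.up ℤ) 0).obj K ⟶ I}
    (hε : IsCartanEilenbergResolution ε) (hK : ∀ n : ℤ, (K.homology n).IsQuasicoherent) :
    QuasiIso (totalAugmentation ε) := by
  refine hε.quasiIso fun A => ?_
  obtain ⟨ι, U, π, hπ⟩ := exists_epi_sigma_freeOn A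
  refine ⟨_, π, hπ, fun p => isHomExact_sigma _ fun i => ?_⟩
  exact @isHomExact_freeOn _ _ (hK p) _ _ (hε.homology p) (U i)

end CartanEilenberg

theorem mainTheorem8 {X : Scheme.{u}}
    [HasDerivedCategory.{w₁} X.Modules] [HasDerivedCategory.{w₂} Ab.{u}]
    {K : CochainComplex X.Modules ℤ} {I : CochainComplex (CochainComplex X.Modules ℤ) ℤ}
    (ε : (HomologicalComplex.single (CochainComplex X.Modules ℤ) (ComplexShape.up ℤ) 0).obj K ⟶ I)
    (hε : IsCartanEilenbergResolution ε) :
    (prodTotal I).IsKInjective ∧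
    ((∀ n : ℤ, (K.homology n).IsQuasicoherent) →
      ∃ _ : QuasiIso (totalAugmentation ε),
        -- `RΓ(X, K)` exists and the canonical morphism `RΓ_ce(X, K) ⟶ RΓ(X, K)` is an isomorphism
        (∃ _ : HasRightDerivedAt (globalSections X) K, IsIso (ceToDerived ε)) ∧
        -- for every K-injective resolution `s : K ⟶ L`, the morphism `φ : J ⟶ L` with `φ η = s`,
        -- which is unique up to homotopy, induces isomorphisms `H^n Γ(X, J) ⟶ H^n Γ(X, L)`
        (∀ (L : CochainComplex X.Modules ℤ) (s : K ⟶ L), L.IsKInjective → QuasiIso s →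
          ∃ φ : prodTotal I ⟶ L,
            Nonempty (Homotopy (totalAugmentation ε ≫ φ) s) ∧
            (∀ φ' : prodTotal I ⟶ L,
              Nonempty (Homotopy (totalAugmentation ε ≫ φ') s) → Nonempty (Homotopy φ' φ)) ∧
            ∀ n : ℤ, IsIso (HomologicalComplex.homologyMap (ceSectionsMap φ) n))) := by
  have hJ := hε.isKInjective
  refine ⟨hJ, fun hK => ?_⟩
  have hη := hε.quasiIso_of_isQuasicoherent hK
  refine ⟨hη, ⟨hasRightDerivedAt_of_isKInjective _ (totalAugmentation ε), ?_⟩, ?_⟩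
  · have := hasRightDerivedAt_of_isKInjective (globalSections X) (totalAugmentation ε)
    exact isIso_toRightDerivedAt _ _
  · intro L s hL hs
    obtain ⟨φ, h₁, h₂, h₃⟩ := exists_comparison (totalAugmentation ε) s
    exact ⟨φ, h₁, h₂, fun n => isIso_homologyMap_of_homotopyEquivalences _ h₃ n⟩
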